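/- **Setting.** Let $(Q,q_0,O,R,\sigma)$ be a sequential object with transition function $\sigma:O\times Q\to R\times Q$. Operations $a,b$ commute in a state $q$ if there are $r_a,r_b\in R$ and $q_1,q_2,q'\in Q$ with $\sigma(a,q)=(r_a,q_1)$, $\sigma(b,q_1)=(r_b,q')$, $\sigma(b,q)=(r_b,q_2)$ and $\sigma(a,q_2)=(r_a,q')$; they conflict, $a\asymp b$, if they do not commute in some state. Two schedules $s,s'\in O^*$ are equivalent, $s\sim s'$, if they contain the same multiset of operations and, whenever $a\asymp b$ and the $i$-th occurrence of $a$ precedes the $j$-th occurrence of $b$ in $s$, it does so in $s'$. Traces are the elements of $O^*/\!\sim$, with concatenation and the prefix order $x\le y\iff\exists z,\ y=x\cdot z$; $ops(x)$ is the multiset of operations of $x$. A set $S$ of traces is compatible, $comp(S)$, if it has a common upper bound. On sets that may contain an extra value $\bot$, $comp$ and $\bigsqcup$ ignore $\bot$ (with $\bigsqcup\emptyset=\epsilon$, the empty trace), and $\bigsqcap S=\bot$ if $\bot\in S$. **Algorithm.** $n$ asynchronous, crash-prone processes share two atomic snapshot objects $A$ and $B$ with $n$ entries, initially $\bot$ and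 $(\bot,\bot)$. Each process $i$ may call $propose(s_i)$ at most once, for any trace $s_i$, and then does the following (each write and each snapshot being one atomic step): 1. $A[i]\gets s_i$; take a snapshot $(a_1,\dots,a_n)$ of $A$; 2. let $a_k^{co}=\bigsqcap(\{a_k\}\cup\{a_j:\neg comp(\{a_j,a_k\})\})$ for each $k$; write $B[i]\gets\bigl(\bigsqcup_k a_k^{co},\ [\forall k,\ a_k=a_k^{co}]\bigr)$; take a snapshot $((b_1,c_1),\dots,(b_n,c_n))$ of $B$; 3. let $\beta_i=\bigsqcap\{b_k: b_k\ne\bot,\ c_k=\mathrm{True}\}$ if some $c_j=\mathrm{True}$, and $\beta_i=b_i$ otherwise; let $w_i$ be the condition that all non-$\bot$ $a_k$ and all non-$\bot$ $b_k$ equal $s_i$; 4. return $(\beta_i,\,c)$, where $c$ is True iff $w_i$ holds, or [$b_k\neq\bot$ for every $k$ with $a_k\ne\bot$ and $a_k\le\beta_i$, and no $c_k$ equals False]. **Theorem.** In $(O^*/\!\sim,\le)$ every non-empty set has a greatest lower bound and every compatible set has a least upper bound, and for every vector $(a_1,\dots,a_n)$ of traces and values $\bot$ the set $\{a_1^{co},\dots,a_n^{co}\}$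 is compatible, so that the algorithm is well defined. The algorithm is a wait-free implementation of Generalized Commit-Adopt: in every execution, finite or infinite, every correct participant's call returns (a process is correct if it takes infinitely many steps or has no pending call); and if $P$ is the set of participants (the processes that invoke $propose$), $s_i$ ($i\in P$) their inputs, $P_r\subseteq P$ the set of those whose calls return, and $(t_i,c_i)$ ($i\in P_r$) their outputs, then: 1. **Validity.** $ops(t_i)\subseteq\bigcup_{j\in P}ops(s_j)$ for all $i\in P_r$, as multisets (the union takes maximal multiplicities). 2. **Adoption.** If $i\in P_r$ and $c_i=\mathrm{True}$, then $t_i\le t_j$ for all $j\in P_r$. 3. **Commitment.** If $P\neq\emptyset$, $\{s_i:i\in P\}$ is compatible and $P=P_r$, then there is $j\in P_r$ with $s_j\le t_j$ and $c_j=\mathrm{True}$. 4. **Convergence.** $\{t_i:i\in P_r\}$ is compatible. 5. **Common prefix.** $\bigsqcap_{j\in P}s_j\le t_i$ for all $i\in P_r$. 6. **Weak Agreement.** If $s_i=s_j$ for all $i,j\in P$, then $c_i=\mathrm{True}$ for all $i\in P_r$. -/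

import Mathlib

/-! ## Sequential objects, conflicts, schedules and traces -/

/-- A sequential data type `(Q, q₀, O, R, σ)`. -/
structure SeqObject (Q O R : Type*) where
  /-- the initial state `q₀` -/
  init : Q
  /-- the transition function `σ : O × Q → R × Q` -/
  trans : O × Q → R × Q

namespace SeqObject

variable {Q O R : Type*}

/-- The operations `a` and `b` commute in the state `q`. -/
def CommuteIn (D : SeqObject Q O R) (q : Q) (a b : O) : Prop :=
  ∃ (ra rb : R) (q₁ q₂ q' : Q),
    D.trans (a, q) = (ra, q₁) ∧ D.trans (b, q₁) = (rb, q') ∧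
    D.trans (b, q) = (rb, q₂) ∧ D.trans (a, q₂) = (ra, q')

/-- The conflict relation: there is a state in which `a` and `b` do not commute. -/
def Conflict (D : SeqObject Q O R) (a b : O) : Prop :=
  ∃ q : Q, ¬ D.CommuteIn q a b

theorem CommuteIn.symm {D : SeqObject Q O R} {q : Q} {a b : O} (h : D.CommuteIn q a b) :
    D.CommuteIn q b a := by
  obtain ⟨ra, rb, q₁, q₂, q', h1, h2, h3, h4⟩ := h
  exact ⟨rb, ra, q₂, q₁, q', h3, h4, h1, h2⟩

theorem Conflict.symm {D : SeqObject Q O R} {a b : O} (h : D.Conflict a b) : D.Conflict b a := by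
  obtain ⟨q, hq⟩ := h
  exact ⟨q, fun h' => hq h'.symm⟩

end SeqObject

namespace Schedule

variable {O : Type*}

open Classical in
/-- The position `k` (counted from `0`) of the schedule `s` holds the `i`-th occurrence
`a⁽ⁱ⁾` of the operation `a`, where `i` is counted from `1`. -/
def IsOcc (s : List O) (a : O) (i k : ℕ) : Prop :=
  s[k]? = some a ∧ (s.take k).count a + 1 = i

/-- The order on occurrences: `a⁽ⁱ⁾ ≺ₛ b⁽ʲ⁾`. -/
def Precedes (s : List O) (a : O) (i : ℕ) (b : O) (j : ℕ) : Prop :=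
  ∃ k l : ℕ, IsOcc s a i k ∧ IsOcc s b j l ∧ k < l

theorem IsOcc.lt_length {s : List O} {a : O} {i k : ℕ} (h : IsOcc s a i k) : k < s.length := by
  by_contra hk
  have h1 := h.1
  rw [List.getElem?_eq_none (by omega)] at h1
  cases h1

open Classical in
theorem isOcc_append {s t : List O} {a : O} {i k : ℕ} :
    IsOcc (s ++ t) a i k ↔ (k < s.length ∧ IsOcc s a i k) ∨
      (s.length ≤ k ∧ s.count a < i ∧ IsOcc t a (i - s.count a) (k - s.length)) := by
  unfold IsOcc
  rcases lt_or_ge k s.length with hk | hk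
  · rw [List.getElem?_append_left hk, List.take_append_of_le_length hk.le]
    constructor
    · intro h; exact Or.inl ⟨hk, h⟩
    · rintro (⟨_, h⟩ | ⟨h, _⟩)
      · exact h
      · omega
  · rw [List.getElem?_append_right hk, List.take_append, List.take_of_length_le hk,
      List.count_append]
    constructor
    · rintro ⟨h1, h2⟩
      exact Or.inr ⟨hk, by omega, h1, by omega⟩
    · rintro (⟨h, _⟩ | ⟨_, h0, h1, h2⟩)
      · omega
      · exact ⟨h1, by omega⟩

open Classical in
theorem IsOcc.bounds {s : List O} {a : O} {i k : ℕ} (h : IsOcc s a i k) :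
    1 ≤ i ∧ i ≤ s.count a := by
  have hk := h.lt_length
  obtain ⟨h1, h2⟩ := h
  refine ⟨by omega, ?_⟩
  have hs : s = s.take k ++ s[k] :: s.drop (k + 1) := by simp
  rw [List.getElem?_eq_getElem hk] at h1
  have h3 : s[k] = a := by simpa using h1
  rw [h3] at hs
  have h4 : s.count a = (s.take k ++ a :: s.drop (k + 1)).count a := congrArg _ hs
  rw [List.count_append, List.count_cons_self] at h4
  omega

open Classical in
theorem exists_isOcc {s : List O} {a : O} {i : ℕ} (h1 : 1 ≤ i) (h2 : i ≤ s.count a) :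
    ∃ k, IsOcc s a i k := by
  induction s using List.reverseRecOn with
  | nil => simp at h2; omega
  | append_singleton s x ih =>
    by_cases hi : i ≤ s.count a
    · obtain ⟨k, hk⟩ := ih hi
      exact ⟨k, isOcc_append.2 (Or.inl ⟨hk.lt_length, hk⟩)⟩
    · rw [List.count_append] at h2
      have hx : x = a := by
        by_contra hx
        rw [List.count_singleton] at h2
        simp [hx] at h2
        omega
      subst hx
      refine ⟨s.length, isOcc_append.2 (Or.inr ⟨le_rfl, by omega, ?_⟩)⟩
      have : List.count x [x] = 1 := by simp
      refine ⟨by simp, ?_⟩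
      simp
      omega

open Classical in
theorem IsOcc.unique {s : List O} {a : O} {i k l : ℕ} (hk : IsOcc s a i k) (hl : IsOcc s a i l) :
    k = l := by
  have key : ∀ {k l : ℕ}, IsOcc s a i k → IsOcc s a i l → ¬ k < l := by
    intro k l hk hl hkl
    have h : IsOcc (s.take l) a i k := by
      refine ⟨?_, ?_⟩
      · rw [List.getElem?_take_of_lt hkl]; exact hk.1
      · rw [List.take_take, min_eq_left hkl.le]; exact hk.2
    have h1 := h.bounds
    have h2 := hl.2
    omega
  exact le_antisymm (not_lt.1 (key hl hk)) (not_lt.1 (key hk hl))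

end Schedule

namespace SeqObject

variable {Q O R : Type*}

open Schedule

/-- Equivalence `s ∼ s'` of schedules: the same multiset of operations, and every precedence
between occurrences of conflicting operations is preserved. -/
def Equivalent (D : SeqObject Q O R) (s s' : List O) : Prop :=
  (s : Multiset O) = (s' : Multiset O) ∧
    ∀ (a b : O) (i j : ℕ), D.Conflict a b → Precedes s a i b j → Precedes s' a i b j

open Classical in
theorem Equivalent.count_eq {D : SeqObject Q O R} {s s' : List O} (h : D.Equivalent s s') (a : O) :
    s.count a = s'.count a := by
  have := congrArg (Multiset.count a) h.1
  simpa using this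

theorem Equivalent.refl (D : SeqObject Q O R) (s : List O) : D.Equivalent s s :=
  ⟨rfl, fun _ _ _ _ _ h => h⟩

theorem Equivalent.symm {D : SeqObject Q O R} {s s' : List O} (h : D.Equivalent s s') :
    D.Equivalent s' s := by
  classical
  refine ⟨h.1.symm, ?_⟩
  rintro a b i j hab ⟨k, l, hk, hl, hkl⟩
  obtain ⟨k', hk'⟩ := exists_isOcc hk.bounds.1 (by rw [h.count_eq]; exact hk.bounds.2)
  obtain ⟨l', hl'⟩ := exists_isOcc hl.bounds.1 (by rw [h.count_eq]; exact hl.bounds.2)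
  rcases lt_trichotomy k' l' with hlt | heq | hgt
  · exact ⟨k', l', hk', hl', hlt⟩
  · exfalso
    subst heq
    have hab' : a = b := by
      have h1 := hk'.1
      rw [hl'.1] at h1
      exact (Option.some.inj h1).symm
    subst hab'
    have hij : i = j := by rw [← hk'.2, ← hl'.2]
    subst hij
    exact hkl.ne (hk.unique hl)
  · exfalso
    obtain ⟨l₂, k₂, hl₂, hk₂, hlt⟩ := h.2 b a j i hab.symm ⟨l', k', hl', hk', hgt⟩
    rw [hl₂.unique hl, hk₂.unique hk] at hlt
    omega

theorem Equivalent.trans {D : SeqObject Q O R} {s t u : List O} (h₁ : D.Equivalent s t)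
    (h₂ : D.Equivalent t u) : D.Equivalent s u :=
  ⟨h₁.1.trans h₂.1, fun a b i j hab h => h₂.2 a b i j hab (h₁.2 a b i j hab h)⟩

theorem Equivalent.append {D : SeqObject Q O R} {s s' t t' : List O} (h : D.Equivalent s s')
    (h' : D.Equivalent t t') : D.Equivalent (s ++ t) (s' ++ t') := by
  classical
  refine ⟨?_, ?_⟩
  · rw [← Multiset.coe_add, ← Multiset.coe_add, h.1, h'.1]
  rintro a b i j hab ⟨k, l, hk, hl, hkl⟩
  rcases isOcc_append.1 hk with ⟨_, hk⟩ | ⟨hks, hki, hk⟩ <;>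
    rcases isOcc_append.1 hl with ⟨_, hl⟩ | ⟨hls, hlj, hl⟩
  · obtain ⟨k', l', hk', hl', hlt⟩ := h.2 a b i j hab ⟨k, l, hk, hl, hkl⟩
    exact ⟨k', l', isOcc_append.2 (Or.inl ⟨hk'.lt_length, hk'⟩),
      isOcc_append.2 (Or.inl ⟨hl'.lt_length, hl'⟩), hlt⟩
  · obtain ⟨k', hk'⟩ := exists_isOcc hk.bounds.1 (by rw [← h.count_eq]; exact hk.bounds.2)
    obtain ⟨l', hl'⟩ := exists_isOcc hl.bounds.1 (by rw [← h'.count_eq]; exact hl.bounds.2)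
    refine ⟨k', l' + s'.length, isOcc_append.2 (Or.inl ⟨hk'.lt_length, hk'⟩),
      isOcc_append.2 (Or.inr ⟨by omega, by rw [← h.count_eq]; exact hlj, ?_⟩), ?_⟩
    · rw [Nat.add_sub_cancel, ← h.count_eq]; exact hl'
    · have := hk'.lt_length; omega
  · omega
  · obtain ⟨k', l', hk', hl', hlt⟩ := h'.2 a b _ _ hab
      ⟨k - s.length, l - s.length, hk, hl, by omega⟩
    refine ⟨k' + s'.length, l' + s'.length,
      isOcc_append.2 (Or.inr ⟨by omega, by rw [← h.count_eq]; exact hki, ?_⟩),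
      isOcc_append.2 (Or.inr ⟨by omega, by rw [← h.count_eq]; exact hlj, ?_⟩), by omega⟩
    · rw [Nat.add_sub_cancel, ← h.count_eq]; exact hk'
    · rw [Nat.add_sub_cancel, ← h.count_eq]; exact hl'

/-- The equivalence of schedules as a setoid. -/
def scheduleSetoid (D : SeqObject Q O R) : Setoid (List O) where
  r := D.Equivalent
  iseqv := ⟨Equivalent.refl D, Equivalent.symm, Equivalent.trans⟩

/-- Traces: the quotient `O* / ∼`. -/
def Trace (D : SeqObject Q O R) : Type _ := Quotient D.scheduleSetoid

namespace Trace

variable {D : SeqObject Q O R}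

/-- The trace `[s]` of a schedule `s`. -/
def mk (D : SeqObject Q O R) (s : List O) : D.Trace := Quotient.mk D.scheduleSetoid s

/-- The empty trace `ε`. -/
instance : One D.Trace := ⟨mk D []⟩

/-- Concatenation `[s] · [t] = [s · t]`. -/
instance : Mul D.Trace :=
  ⟨Quotient.map₂ (· ++ ·) fun _ _ h _ _ h' => Equivalent.append h h'⟩

/-- The multiset of operations of a trace. -/
def ops (x : D.Trace) : Multiset O :=
  Quotient.lift (s := D.scheduleSetoid) (fun s : List O => (s : Multiset O))
    (fun s t h => (show D.Equivalent s t from h).1) x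

instance : Monoid D.Trace where
  mul_assoc x y z := by
    induction x using Quotient.inductionOn
    induction y using Quotient.inductionOn
    induction z using Quotient.inductionOn
    exact congrArg (mk D) (List.append_assoc _ _ _)
  one_mul x := by
    induction x using Quotient.inductionOn
    exact congrArg (mk D) (List.nil_append _)
  mul_one x := by
    induction x using Quotient.inductionOn
    exact congrArg (mk D) (List.append_nil _)

theorem ops_mul (x y : D.Trace) : ops (x * y) = ops x + ops y := by
  induction x using Quotient.inductionOn
  induction y using Quotient.inductionOn
  exact (Multiset.coe_add _ _).symm

theorem eq_one_of_ops_eq_zero {x : D.Trace} (h : ops x = 0) : x = 1 := by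
  induction x using Quotient.inductionOn with
  | h s =>
    have hs : s = [] := Multiset.coe_eq_zero s |>.1 h
    subst hs
    rfl

/-- The prefix order: `x ≤ y` if `y = x · z` for some `z`. -/
instance : PartialOrder D.Trace where
  le x y := ∃ z : D.Trace, y = x * z
  le_refl x := ⟨1, (mul_one x).symm⟩
  le_trans := by
    rintro x y z ⟨u, rfl⟩ ⟨v, rfl⟩
    exact ⟨u * v, mul_assoc x u v⟩
  le_antisymm := by
    rintro x y ⟨u, rfl⟩ ⟨v, hv⟩
    have h := congrArg ops hv
    rw [ops_mul, ops_mul, add_assoc, left_eq_add] at h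
    have hu : ops u = 0 := (add_eq_zero.1 h).1
    rw [eq_one_of_ops_eq_zero hu, mul_one]

/-- A set of traces is compatible if its members have a common extension. -/
def Compatible (S : Set D.Trace) : Prop := ∃ z : D.Trace, ∀ x ∈ S, x ≤ z

open Classical in
/-- The greatest lower bound `⨅ S` (and the empty trace if there is none). -/
noncomputable def glb (S : Set D.Trace) : D.Trace :=
  if h : ∃ e, IsGLB S e then h.choose else 1

open Classical in
/-- The least upper bound `⨆ S` (and the empty trace if there is none). -/
noncomputable def lub (S : Set D.Trace) : D.Trace :=
  if h : ∃ e, IsLUB S e then h.choose else 1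

/-! The extension of these notions to sets of traces and values `⊥`, where `none` is `⊥`. -/

/-- The traces in a set of traces and `⊥` values. -/
def proper (S : Set (Option D.Trace)) : Set D.Trace := {x | some x ∈ S}

/-- Compatibility is computed on the traces of the set. -/
def CompatibleBot (S : Set (Option D.Trace)) : Prop := Compatible (proper S)

/-- The least upper bound is computed on the traces of the set. -/
noncomputable def lubBot (S : Set (Option D.Trace)) : D.Trace := lub (proper S)

open Classical in
/-- The greatest lower bound is `⊥` as soon as `⊥` belongs to the set. -/
noncomputable def glbBot (S : Set (Option D.Trace)) : Option D.Trace :=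
  if none ∈ S then none else some (glb (proper S))

end Trace

/-- The prefix order makes the traces a bounded complete meet-semilattice: every non-empty set has
a greatest lower bound, and every compatible set has a least upper bound. -/
def IsTraceSemilattice (D : SeqObject Q O R) : Prop :=
  (∀ S : Set D.Trace, S.Nonempty → ∃ e, IsGLB S e) ∧
    ∀ S : Set D.Trace, Trace.Compatible S → ∃ e, IsLUB S e

end SeqObject

/-! ## Generalized Commit-Adopt -/

open Classical in
/-- The safety properties of Generalized Commit-Adopt for `n` processes. `inp i = some s` means that
process `i` invokes `propose s`, and `inp i = none` that `i` is not a participant;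
`out i = some (t, c)` means that the call of `i` returns `(t, c)`, and `out i = none` that no call
of `i` returns. -/
structure GCASpec {Q O R : Type*} {D : SeqObject Q O R} {n : ℕ} (inp : Fin n → Option D.Trace)
    (out : Fin n → Option (D.Trace × Bool)) : Prop where
  /-- only participants return -/
  returns_of_participant : ∀ i, out i ≠ none → inp i ≠ none
  /-- the union is that of multisets (the largest multiplicity), the inclusion respects
  multiplicities -/
  validity : ∀ i t c, out i = some (t, c) →
    t.ops ≤ Finset.univ.sup fun j => (inp j).elim (0 : Multiset O) SeqObject.Trace.ops
  adoption : ∀ i t, out i = some (t, true) → ∀ j t' c', out j = some (t', c') → t ≤ t'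
  commitment : (∃ i, inp i ≠ none) → SeqObject.Trace.Compatible {s | ∃ i, inp i = some s} →
    (∀ i, inp i ≠ none → out i ≠ none) →
    ∃ j s t, inp j = some s ∧ out j = some (t, true) ∧ s ≤ t
  convergence : SeqObject.Trace.Compatible {t | ∃ i c, out i = some (t, c)}
  commonPrefix : ∀ i t c, out i = some (t, c) →
    ∃ g, IsGLB {s | ∃ j, inp j = some s} g ∧ g ≤ t
  weakAgreement : (∀ i j s s', inp i = some s → inp j = some s' → s = s') →
    ∀ i t c, out i = some (t, c) → c = true

/-! ## The algorithm -/

namespace GCA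

open SeqObject SeqObject.Trace

variable {Q O R : Type*} {D : SeqObject Q O R} {n : ℕ}

/-- The vector `A^co`: the `k`-th entry is the greatest lower bound of `a k` and of all the entries
that are not compatible with it. -/
noncomputable def co (a : Fin n → Option D.Trace) (k : Fin n) : Option D.Trace :=
  glbBot ({a k} ∪ {x | ∃ j, x = a j ∧ ¬ CompatibleBot {a j, a k}})

open Classical in
/-- The pair that a process with the view `a` of the first snapshot object writes into the second
one. -/
noncomputable def candidate (a : Fin n → Option D.Trace) : D.Trace × Bool :=
  (lubBot (Set.range (co a)), decide (a = co a))

open Classical in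
/-- The output trace `β` of process `i` with the view `b` of the second snapshot object. An entry
`none` of `b` stands for `(⊥, ⊥)`; the own entry `b i` has been written when this is evaluated. -/
noncomputable def outTrace (i : Fin n) (b : Fin n → Option (D.Trace × Bool)) : D.Trace :=
  if ∃ j x, b j = some (x, true) then glb {x | ∃ k, b k = some (x, true)}
  else (b i).elim 1 Prod.fst

/-- The weak-agreement flag `w` of a process with input `s` and views `a` and `b`. -/
def WeakFlag (s : D.Trace) (a : Fin n → Option D.Trace) (b : Fin n → Option (D.Trace × Bool)) :
    Prop :=
  (∀ k x, a k = some x → x = s) ∧ ∀ k x c, b k = some (x, c) → x = s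

open Classical in
/-- The Boolean that process `i` with input `s` and views `a` and `b` returns. -/
noncomputable def outFlag (i : Fin n) (s : D.Trace) (a : Fin n → Option D.Trace)
    (b : Fin n → Option (D.Trace × Bool)) : Bool :=
  decide (WeakFlag s a b ∨
    ((∀ k x, a k = some x → x ≤ outTrace i b → b k ≠ none) ∧ ¬ ∃ k x, b k = some (x, false)))

/-- The local state of a process: the instruction it executes next and its local variables (the
input `s`, the view `a` of the first snapshot object, the view `b` of the second one). -/
inductive Local (D : SeqObject Q O R) (n : ℕ) where
  /-- not invoked yet -/
  | idle
  /-- about to write `s` into its entry of the first snapshot object -/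
  | writeA (s : D.Trace)
  /-- about to take a snapshot of the first snapshot object -/
  | snapA (s : D.Trace)
  /-- about to compute its candidate and to write it into its entry of the second object -/
  | writeB (s : D.Trace) (a : Fin n → Option D.Trace)
  /-- about to take a snapshot of the second snapshot object -/
  | snapB (s : D.Trace) (a : Fin n → Option D.Trace)
  /-- about to compute its output and to return -/
  | respond (s : D.Trace) (a : Fin n → Option D.Trace) (b : Fin n → Option (D.Trace × Bool))
  /-- has returned `(t, c)` -/
  | done (s : D.Trace) (t : D.Trace) (c : Bool)

/-- The input of a process, if it has been invoked. -/
def Local.input : Local D n → Option D.Trace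
  | .idle => none
  | .writeA s => some s
  | .snapA s => some s
  | .writeB s _ => some s
  | .snapB s _ => some s
  | .respond s _ _ => some s
  | .done s _ _ => some s

/-- The output of a process, if it has returned. -/
def Local.output : Local D n → Option (D.Trace × Bool)
  | .done _ t c => some (t, c)
  | _ => none

/-- A configuration: the contents of the two snapshot objects and the local states. -/
structure Config (D : SeqObject Q O R) (n : ℕ) where
  /-- the first snapshot object -/
  A : Fin n → Option D.Trace
  /-- the second snapshot object -/
  B : Fin n → Option (D.Trace × Bool)
  /-- the local states -/
  loc : Fin n → Local D n

/-- The initial configuration. -/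
def Config.init (D : SeqObject Q O R) (n : ℕ) : Config D n where
  A _ := none
  B _ := none
  loc _ := .idle

/-- Process `i` is invoked with the input `s`, or process `i` takes a step. -/
inductive Event (D : SeqObject Q O R) (n : ℕ) where
  | invoke (i : Fin n) (s : D.Trace)
  | step (i : Fin n)

/-- The effect of an event. A step performs at most one atomic operation (an update of the own entry
or a snapshot) on one of the two objects. The object is one-shot: a second invocation has no effect,
and neither has a step of a process that is not invoked or has returned. -/
noncomputable def Config.next (C : Config D n) : Event D n → Config D n
  | .invoke i s =>
    match C.loc i with
    | .idle => { C with loc := Function.update C.loc i (.writeA s) }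
    | _ => C
  | .step i =>
    match C.loc i with
    | .idle => C
    | .writeA s =>
      { C with A := Function.update C.A i (some s), loc := Function.update C.loc i (.snapA s) }
    | .snapA s => { C with loc := Function.update C.loc i (.writeB s C.A) }
    | .writeB s a =>
      { C with
        B := Function.update C.B i (some (candidate a))
        loc := Function.update C.loc i (.snapB s a) }
    | .snapB s a => { C with loc := Function.update C.loc i (.respond s a C.B) }
    | .respond s a b =>
      { C with loc := Function.update C.loc i (.done s (outTrace i b) (outFlag i s a b)) }
    | .done _ _ _ => C

/-- An execution, given by the event that takes place at each time; `none` means that nothing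
happens, so that the finite executions are those which are eventually `none`. -/
def Execution (D : SeqObject Q O R) (n : ℕ) : Type _ := ℕ → Option (Event D n)

/-- The configurations that an execution goes through. -/
noncomputable def Execution.run (e : Execution D n) : ℕ → Config D n
  | 0 => Config.init D n
  | τ + 1 => (e τ).elim (e.run τ) (e.run τ).next

/-- The inputs and outputs of an execution: `inp i = some s` if and only if process `i` is invoked
with the input `s`, and `out i = some r` if and only if the call of process `i` returns `r`. -/
def Execution.HasOutcome (e : Execution D n) (inp : Fin n → Option D.Trace)
    (out : Fin n → Option (D.Trace × Bool)) : Prop :=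
  (∀ i s, inp i = some s ↔ ∃ τ, ((e.run τ).loc i).input = some s) ∧
    ∀ i r, out i = some r ↔ ∃ τ, ((e.run τ).loc i).output = some r

/-- A process is correct if it takes infinitely many steps or has no pending call (a call is pending
if it is invoked and never returns). -/
def Execution.Correct (e : Execution D n) (i : Fin n) : Prop :=
  (∀ τ₀, ∃ τ, τ₀ ≤ τ ∧ e τ = some (.step i)) ∨
    ¬ ((∃ τ, ((e.run τ).loc i).input ≠ none) ∧ ∀ τ, ((e.run τ).loc i).output = none)

/-- Wait-freedom: in every execution, the call of every correct participant returns. -/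
def WaitFree (D : SeqObject Q O R) (n : ℕ) : Prop :=
  ∀ (e : Execution D n) (i : Fin n), e.Correct i → (∃ τ, ((e.run τ).loc i).input ≠ none) →
    ∃ τ, ((e.run τ).loc i).output ≠ none

end GCA

/-! ## The prefix order on traces -/

namespace Schedule

variable {O : Type*}

/-! Order theory of traces. Concatenation is left cancellative (`letter_mul_cancel`), and two
different operations that can both begin a trace do not conflict (`exists_of_letter_mul_eq`).
Induction on the first operation therefore yields the join of two bounded traces, with no operations
beyond the multiset union of theirs (`exists_isLUB_pair`). Larger bounded joins exist because
lengths are bounded, and meets are joins of lower bounds. The decisive fact is coherence: finitely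
many pairwise compatible traces are compatible (`exists_upper_bound_of_pairwise`,
`compatible_of_pairwise`).

Safety. It depends on an execution only through `ViewHistory`: the contents of each snapshot object
grow along a chain, and a view contains the entry of its owner. If incompatible inputs `x`, `x'`
occur in comparable views, the larger view sees both, so its entry for either is cut below the
other; hence all candidates are compatible (`co_compatible_of_le`). Outputs lie below a candidate
and above every common lower bound of the candidates seen, which gives validity, convergence and
common prefix.

A candidate flagged True is the join of the raw view, so True candidates increase with the view. For
adoption, a committed output is the least candidate seen (or the common input, for the weak flag). A
True candidate from a smaller view belongs to a process whose input is below that output, and the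
coverage test ensures that its candidate was already seen. For commitment, take the least candidate
and, among the processes with input below it, the one with the last view of `B`.

Wait-freedom holds because a call consists of five steps. -/

open Classical in
theorem isOcc_cons_succ {s : List O} {a b : O} {i k : ℕ} :
    IsOcc (a :: s) b (i + [a].count b) (k + 1) ↔ IsOcc s b i k := by
  unfold IsOcc
  rw [List.getElem?_cons_succ, List.take_succ_cons, List.count_cons, List.count_cons,
    List.count_nil]
  refine and_congr_right fun _ => ?_
  omega

-- Prepending `a` raises the occurrence number of `b` by `[a].count b`, which is one if `b = a` and
-- zero otherwise. The bounds `1 ≤ i` and `1 ≤ j` keep both occurrences away from the new first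
-- position.
open Classical in
theorem precedes_cons {s : List O} {a b c : O} {i j : ℕ} (hi : 1 ≤ i) (hj : 1 ≤ j) :
    Precedes (a :: s) b (i + [a].count b) c (j + [a].count c) ↔ Precedes s b i c j := by
  have key : ∀ {d : O} {m k : ℕ}, 1 ≤ m → IsOcc (a :: s) d (m + [a].count d) k →
      ∃ k', k = k' + 1 := by
    rintro d m (_ | k) hm h
    · have h1 : a = d := by simpa using h.1
      subst h1
      have h2 := h.2
      simp at h2
      omega
    · exact ⟨k, rfl⟩
  constructor
  · rintro ⟨k, l, hk, hl, hkl⟩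
    obtain ⟨k, rfl⟩ := key hi hk
    obtain ⟨l, rfl⟩ := key hj hl
    exact ⟨k, l, isOcc_cons_succ.1 hk, isOcc_cons_succ.1 hl, by omega⟩
  · rintro ⟨k, l, hk, hl, hkl⟩
    exact ⟨k + 1, l + 1, isOcc_cons_succ.2 hk, isOcc_cons_succ.2 hl, by omega⟩

theorem isOcc_cons_zero (s : List O) (a : O) : IsOcc (a :: s) a 1 0 := ⟨rfl, rfl⟩

end Schedule

namespace SeqObject

variable {Q O R : Type*} {D : SeqObject Q O R}

open Schedule

/-! ### Cancellation and commutation of single operations -/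

theorem Equivalent.of_cons {a : O} {s t : List O} (h : D.Equivalent (a :: s) (a :: t)) :
    D.Equivalent s t := by
  classical
  refine ⟨?_, ?_⟩
  · have h1 := h.1
    rwa [← Multiset.cons_coe, ← Multiset.cons_coe, Multiset.cons_inj_right] at h1
  · intro b c i j hbc hp
    obtain ⟨k, l, hk, hl, -⟩ := id hp
    have hi := hk.bounds.1
    have hj := hl.bounds.1
    exact (precedes_cons hi hj).1 (h.2 b c _ _ hbc ((precedes_cons hi hj).2 hp))

/-- In a schedule equivalent to one that starts with `a`, nothing before the first occurrence of `a`
conflicts with `a`. -/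
theorem Equivalent.not_conflict_of_cons {a : O} {s t u : List O}
    (h : D.Equivalent (a :: s) (t ++ a :: u)) (ha : a ∉ t) {c : O} (hc : c ∈ t) :
    ¬ D.Conflict c a := by
  classical
  intro hca
  obtain ⟨k, hk⟩ := exists_isOcc le_rfl (List.one_le_count_iff.2 hc)
  have hl : IsOcc (t ++ a :: u) a 1 t.length := by
    refine isOcc_append.2 (Or.inr ⟨le_rfl, ?_, ?_⟩)
    · rw [List.count_eq_zero_of_not_mem ha]; exact one_pos
    · rw [List.count_eq_zero_of_not_mem ha, Nat.sub_self]; exact isOcc_cons_zero u a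
  -- By symmetry of the equivalence, the first `c` would also precede the first `a` in `a :: s`,
  -- where that `a` has position 0.
  obtain ⟨k', l', -, hl', hlt⟩ := h.symm.2 c a 1 1 hca
    ⟨k, _, isOcc_append.2 (Or.inl ⟨hk.lt_length, hk⟩), hl, hk.lt_length⟩
  rw [hl'.unique (isOcc_cons_zero s a)] at hlt
  omega

theorem equivalent_swap {a b : O} (h : ¬ D.Conflict a b) : D.Equivalent [a, b] [b, a] := by
  refine ⟨Multiset.coe_eq_coe.2 (List.Perm.swap b a []), ?_⟩
  rintro c d i j hcd ⟨k, l, hk, hl, hkl⟩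
  have hl2 := hl.lt_length
  simp only [List.length_cons, List.length_nil] at hl2
  obtain rfl : k = 0 := by omega
  obtain rfl : l = 1 := by omega
  have h1 : a = c := by simpa using hk.1
  have h2 : b = d := by simpa using hl.1
  subst h1 h2
  exact absurd hcd h

namespace Trace

/-- The trace of a single operation. -/
def letter (D : SeqObject Q O R) (a : O) : D.Trace := mk D [a]

theorem mk_append (s t : List O) : mk D (s ++ t) = mk D s * mk D t := rfl

theorem mk_cons (a : O) (s : List O) : mk D (a :: s) = letter D a * mk D s := rfl

theorem mk_eq_mk {s t : List O} : mk D s = mk D t ↔ D.Equivalent s t :=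
  Quotient.eq (r := D.scheduleSetoid)

theorem exists_mk (x : D.Trace) : ∃ s, mk D s = x := Quotient.exists_rep x

@[elab_as_elim]
theorem letter_induction {p : D.Trace → Prop} (x : D.Trace) (one : p 1)
    (letter_mul : ∀ a x, p x → p (letter D a * x)) : p x := by
  obtain ⟨s, rfl⟩ := exists_mk x
  induction s with
  | nil => exact one
  | cons a s ih => exact letter_mul a _ ih

theorem ops_one : ops (1 : D.Trace) = 0 := rfl

theorem ops_letter_mul (a : O) (x : D.Trace) : ops (letter D a * x) = a ::ₘ ops x := by
  rw [ops_mul]; rfl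

theorem letter_mul_cancel {a : O} {x y : D.Trace} (h : letter D a * x = letter D a * y) :
    x = y := by
  obtain ⟨s, rfl⟩ := exists_mk x
  obtain ⟨t, rfl⟩ := exists_mk y
  exact mk_eq_mk.2 (mk_eq_mk.1 h).of_cons

theorem le_mul (x y : D.Trace) : x ≤ x * y := ⟨y, rfl⟩

theorem one_le (x : D.Trace) : 1 ≤ x := ⟨x, (one_mul x).symm⟩

theorem letter_mul_le {a : O} {x y : D.Trace} :
    letter D a * x ≤ letter D a * y ↔ x ≤ y := by
  constructor
  · rintro ⟨z, hz⟩
    rw [mul_assoc] at hz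
    exact ⟨z, letter_mul_cancel hz⟩
  · rintro ⟨z, rfl⟩
    exact ⟨z, (mul_assoc _ _ _).symm⟩

theorem ops_mono {x y : D.Trace} (h : x ≤ y) : ops x ≤ ops y := by
  obtain ⟨z, rfl⟩ := h
  rw [ops_mul]
  exact Multiset.le_add_right _ _

theorem eq_of_le_of_card_le {x y : D.Trace} (h : x ≤ y)
    (hc : Multiset.card (ops y) ≤ Multiset.card (ops x)) : x = y := by
  obtain ⟨z, rfl⟩ := h
  rw [ops_mul, Multiset.card_add] at hc
  rw [eq_one_of_ops_eq_zero (x := z) (Multiset.card_eq_zero.1 (by omega)), mul_one]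

theorem letter_comm {a b : O} (h : ¬ D.Conflict a b) :
    letter D a * letter D b = letter D b * letter D a :=
  mk_eq_mk.2 (equivalent_swap h)

theorem letter_comm_of_not_conflict {a : O} {x : D.Trace} (h : ∀ b ∈ ops x, ¬ D.Conflict a b) :
    letter D a * x = x * letter D a := by
  induction x using letter_induction with
  | one => rw [one_mul, mul_one]
  | letter_mul b x ih =>
    simp only [ops_letter_mul, Multiset.mem_cons, forall_eq_or_imp] at h
    rw [← mul_assoc, letter_comm h.1, mul_assoc, ih h.2, mul_assoc]

/-- Two different operations that both may come first do not conflict. -/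
theorem exists_of_letter_mul_eq {a b : O} {x y : D.Trace} (h : letter D a * x = letter D b * y)
    (hab : a ≠ b) : ¬ D.Conflict a b ∧ letter D a ≤ y := by
  classical
  obtain ⟨s, rfl⟩ := exists_mk x
  obtain ⟨t, rfl⟩ := exists_mk y
  have he : D.Equivalent (a :: s) (b :: t) := mk_eq_mk.1 h
  have hmem : a ∈ b :: t := by
    have : a ∈ ((a :: s : List O) : Multiset O) := by simp
    rw [he.1] at this
    simpa using this
  have hat : a ∈ t := (List.mem_cons.1 hmem).resolve_left hab
  obtain ⟨t₁, t₂, rfl, ht₁⟩ := List.eq_append_cons_of_mem hat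
  -- Everything before the first `a` of `b :: t`, including `b` itself, is independent of `a`; hence
  -- `a` can be moved to the front of `t`.
  have hnot : ∀ c ∈ b :: t₁, ¬ D.Conflict c a := fun c hc =>
    Equivalent.not_conflict_of_cons (t := b :: t₁) he (by simp [hab, ht₁]) hc
  refine ⟨fun hc => hnot b (by simp) hc.symm, ?_⟩
  rw [mk_append, mk_cons, ← mul_assoc, ← letter_comm_of_not_conflict, mul_assoc]
  · exact le_mul _ _
  · intro c hc hac
    exact hnot c (List.mem_cons_of_mem _ hc) hac.symm

theorem letter_le_of_letter_le {a b : O} {z : D.Trace} (ha : letter D a ≤ letter D b * z)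
    (hab : a ≠ b) : ¬ D.Conflict a b ∧ letter D a ≤ z := by
  obtain ⟨x, hx⟩ := ha
  exact exists_of_letter_mul_eq hx.symm hab

theorem exists_eq_letter_mul {a : O} {x z : D.Trace} (h : letter D a * x ≤ z) :
    ∃ z', z = letter D a * z' ∧ x ≤ z' := by
  obtain ⟨u, rfl⟩ := h
  exact ⟨x * u, mul_assoc _ _ _, le_mul _ _⟩

/-- An operation compatible with `x` either may come first in `x` or is independent of `x`. -/
theorem letter_le_or_independent {a : O} {x z : D.Trace} (ha : letter D a ≤ z) (hx : x ≤ z) :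
    letter D a ≤ x ∨ ∀ b ∈ ops x, b ≠ a ∧ ¬ D.Conflict a b := by
  induction x using letter_induction generalizing z with
  | one => right; simp [ops_one]
  | letter_mul b x ih =>
    rcases eq_or_ne a b with rfl | hab
    · exact Or.inl (le_mul _ _)
    · obtain ⟨z, rfl, hxz⟩ := exists_eq_letter_mul hx
      obtain ⟨hc, ha⟩ := letter_le_of_letter_le ha hab
      rcases ih ha hxz with ⟨u, rfl⟩ | h
      · left
        rw [← mul_assoc, ← letter_comm hc, mul_assoc]
        exact le_mul _ _
      · right
        simp only [ops_letter_mul, Multiset.mem_cons, forall_eq_or_imp]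
        exact ⟨⟨hab.symm, hc⟩, h⟩

/-- Strip the first operation `b` of `x` from `z`: since `b ≠ a`, the letter `a` remains a prefix of
what is left, and it commutes past `b`. -/
theorem letter_mul_le_of_independent {a : O} {x z : D.Trace}
    (h : ∀ b ∈ ops x, b ≠ a ∧ ¬ D.Conflict a b) (ha : letter D a ≤ z) (hx : x ≤ z) :
    letter D a * x ≤ z := by
  induction x using letter_induction generalizing z with
  | one => rwa [mul_one]
  | letter_mul b x ih =>
    simp only [ops_letter_mul, Multiset.mem_cons, forall_eq_or_imp] at h
    obtain ⟨z, rfl, hxz⟩ := exists_eq_letter_mul hx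
    rw [← mul_assoc, letter_comm h.1.2, mul_assoc, letter_mul_le]
    exact ih h.2 (letter_le_of_letter_le ha h.1.1.symm).2 hxz

/-! ### Least upper bounds and greatest lower bounds -/

open Classical in
theorem exists_isLUB_pair {x y z : D.Trace} (hx : x ≤ z) (hy : y ≤ z) :
    ∃ e, IsLUB {x, y} e ∧ ops e ≤ ops x ∪ ops y := by
  have isLUB_pair : ∀ {u v e : D.Trace}, IsLUB {u, v} e ↔
      (u ≤ e ∧ v ≤ e) ∧ ∀ w, u ≤ w → v ≤ w → e ≤ w := by
    intro u v e
    simp [IsLUB, IsLeast, lowerBounds, upperBounds]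
  induction x using letter_induction generalizing y z with
  | one =>
    exact ⟨y, isLUB_pair.2 ⟨⟨one_le y, le_rfl⟩, fun _ _ h => h⟩, Multiset.le_union_right⟩
  | letter_mul a x ih =>
    obtain ⟨z, rfl, hxz⟩ := exists_eq_letter_mul hx
    -- Either `a` also begins `y` and is stripped from both traces, or it is independent of `y`. In
    -- the second case every upper bound of `a · x` and `y` is above `a · y`, so the join is `a`
    -- times the join of `x` and `y`.
    rcases letter_le_or_independent (le_mul (letter D a) z) hy with ⟨y, rfl⟩ | hind
    · obtain ⟨e, he, ho⟩ := ih hxz (letter_mul_le.1 hy)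
      rw [isLUB_pair] at he
      refine ⟨letter D a * e, isLUB_pair.2 ⟨⟨letter_mul_le.2 he.1.1, letter_mul_le.2 he.1.2⟩, ?_⟩, ?_⟩
      · intro w h1 h2
        obtain ⟨w, rfl, h1w⟩ := exists_eq_letter_mul h1
        exact letter_mul_le.2 (he.2 w h1w (letter_mul_le.1 h2))
      · rw [Multiset.le_iff_count] at ho ⊢
        intro b
        have := ho b
        simp only [ops_letter_mul, Multiset.count_union, Multiset.count_cons] at this ⊢
        omega
    · have hay := letter_mul_le_of_independent hind (le_mul (letter D a) z) hy
      obtain ⟨e, he, ho⟩ := ih hxz (letter_mul_le.1 hay)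
      rw [isLUB_pair] at he
      have hya : y ≤ letter D a * y := by
        rw [letter_comm_of_not_conflict fun b hb => (hind b hb).2]
        exact le_mul _ _
      refine ⟨letter D a * e, isLUB_pair.2 ⟨⟨letter_mul_le.2 he.1.1,
        hya.trans (letter_mul_le.2 he.1.2)⟩, ?_⟩, ?_⟩
      · intro w h1 h2
        have h3 := letter_mul_le_of_independent hind ((le_mul _ _).trans h1) h2
        obtain ⟨w, rfl, h1w⟩ := exists_eq_letter_mul h1
        exact letter_mul_le.2 (he.2 w h1w (letter_mul_le.1 h3))
      · rw [Multiset.le_iff_count] at ho ⊢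
        intro b
        have := ho b
        simp only [ops_letter_mul, Multiset.count_union, Multiset.count_cons] at this ⊢
        by_cases hb : b = a
        · subst hb
          have : Multiset.count b (ops y) = 0 :=
            Multiset.count_eq_zero.2 fun hb => (hind b hb).1 rfl
          simp only [if_true]
          omega
        · simp only [hb, if_false]
          omega

/-- A compatible set has a least upper bound, which contains no more operations than needed. -/
theorem exists_isLUB_ops {S : Set D.Trace} (hS : Compatible S) :
    ∃ e, IsLUB S e ∧ ∀ m : Multiset O, (∀ x ∈ S, ops x ≤ m) → ops e ≤ m := by
  classical
  obtain ⟨z, hz⟩ := hS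
  let T : Set D.Trace := {t | (∀ w ∈ upperBounds S, t ≤ w) ∧
    ∀ m : Multiset O, (∀ x ∈ S, ops x ≤ m) → ops t ≤ m}
  -- Members of `T` are below `z`, so minimizing this difference picks a longest one. Joining it
  -- with any `x ∈ S` stays inside `T`, so the join cannot be longer, which forces `x ≤ t`.
  obtain ⟨t, ht, hmin⟩ := WellFounded.has_min
    (measure fun t : D.Trace => Multiset.card (ops z) - Multiset.card (ops t)).wf T
    ⟨1, fun w _ => one_le w, fun m _ => by rw [ops_one]; exact Multiset.zero_le m⟩
  refine ⟨t, ⟨fun x hx => ?_, ht.1⟩, ht.2⟩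
  obtain ⟨e, he, ho⟩ := exists_isLUB_pair (ht.1 z hz) (hz x hx)
  have hte : t ≤ e := he.1 (by simp)
  have hez : e ≤ z := he.2 (by rintro _ (rfl | rfl); exacts [ht.1 z hz, hz _ hx])
  have heT : e ∈ T := by
    refine ⟨fun w hw => he.2 (by rintro _ (rfl | rfl); exacts [ht.1 w hw, hw hx]), fun m hm => ?_⟩
    exact ho.trans (Multiset.union_le (ht.2 m hm) (hm x hx))
  have h1 := hmin e heT
  have h2 := Multiset.card_le_card (ops_mono hez)
  have h3 := Multiset.card_le_card (ops_mono hte)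
  rw [eq_of_le_of_card_le hte (by change ¬ (Multiset.card _ - _ < _ - _) at h1; omega)]
  exact he.1 (by simp)

/-- The lower bounds of `S` are compatible, any member of `S` being above them; their join is the
meet of `S`. -/
theorem exists_isGLB {S : Set D.Trace} (hS : S.Nonempty) : ∃ e, IsGLB S e := by
  obtain ⟨x, hx⟩ := hS
  obtain ⟨e, he, -⟩ := exists_isLUB_ops (S := lowerBounds S) ⟨x, fun y hy => hy hx⟩
  exact ⟨e, isLUB_lowerBounds.1 he⟩

theorem isTraceSemilattice : D.IsTraceSemilattice :=
  ⟨fun _ hS => exists_isGLB hS, fun _ hS => (exists_isLUB_ops hS).imp fun _ h => h.1⟩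

theorem isGLB_glb {S : Set D.Trace} (hS : S.Nonempty) : IsGLB S (glb S) := by
  rw [glb, dif_pos (exists_isGLB hS)]
  exact (exists_isGLB hS).choose_spec

theorem isLUB_lub {S : Set D.Trace} (hS : Compatible S) : IsLUB S (lub S) := by
  have h : ∃ e, IsLUB S e := (exists_isLUB_ops hS).imp fun _ h => h.1
  rw [lub, dif_pos h]
  exact h.choose_spec

theorem ops_le_of_isLUB {S : Set D.Trace} {e : D.Trace} (he : IsLUB S e) {m : Multiset O}
    (hm : ∀ x ∈ S, ops x ≤ m) : ops e ≤ m := by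
  obtain ⟨e', he', h⟩ := exists_isLUB_ops ⟨e, he.1⟩
  rw [he.unique he']
  exact h m hm

/-! ### Coherence: pairwise compatibility suffices -/

theorem compatible_pair {x y : D.Trace} : Compatible {x, y} ↔ ∃ z, x ≤ z ∧ y ≤ z := by
  simp [Compatible]

theorem compatible_pair_comm {x y : D.Trace} : Compatible {x, y} ↔ Compatible {y, x} := by
  rw [Set.pair_comm]

theorem Compatible.mono {x x' y y' : D.Trace} (h : Compatible {x', y'}) (hx : x ≤ x')
    (hy : y ≤ y') : Compatible {x, y} := by
  obtain ⟨z, h1, h2⟩ := compatible_pair.1 h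
  exact compatible_pair.2 ⟨z, hx.trans h1, hy.trans h2⟩

/-- Induction on `w`. Its first operation `a` is compatible with the join of `x` and `y`, so `x` and
`y` may be enlarged to traces that begin with `a`; stripping `a` from all three leaves pairwise
compatible traces. -/
theorem exists_upper_bound_of_pairwise {x y w : D.Trace} (hxy : Compatible {x, y})
    (hxw : Compatible {x, w}) (hyw : Compatible {y, w}) : ∃ z, x ≤ z ∧ y ≤ z ∧ w ≤ z := by
  classical
  simp only [compatible_pair] at hxy hxw hyw
  induction w using letter_induction generalizing x y with
  | one =>
    obtain ⟨z, hx, hy⟩ := hxy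
    exact ⟨z, hx, hy, one_le z⟩
  | letter_mul a w ih =>
    obtain ⟨r, hxr, hyr⟩ := hxy
    obtain ⟨p, hxp, hwp⟩ := hxw
    obtain ⟨q, hyq, hwq⟩ := hyw
    obtain ⟨p, rfl, hwp'⟩ := exists_eq_letter_mul hwp
    obtain ⟨q, rfl, hwq'⟩ := exists_eq_letter_mul hwq
    obtain ⟨e, he, ho⟩ := exists_isLUB_pair hxr hyr
    have hxe : x ≤ e := he.1 (by simp)
    have hye : y ≤ e := he.1 (by simp)
    -- If `a` begins neither `x` nor `y`, it is independent of both, hence of `e`, whose operations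
    -- all come from `x` or `y`. Then `a · e` extends `e`.
    obtain ⟨f, hef, haf⟩ : ∃ f, e ≤ f ∧ letter D a ≤ f := by
      rcases letter_le_or_independent (le_mul (letter D a) p) hxp with h | hx
      · exact ⟨e, le_rfl, h.trans hxe⟩
      rcases letter_le_or_independent (le_mul (letter D a) q) hyq with h | hy
      · exact ⟨e, le_rfl, h.trans hye⟩
      refine ⟨letter D a * e, ?_, le_mul _ _⟩
      rw [letter_comm_of_not_conflict]
      · exact le_mul _ _
      · intro b hb
        rcases Multiset.mem_union.1 (Multiset.mem_of_le ho hb) with hb | hb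
        exacts [(hx b hb).2, (hy b hb).2]
    obtain ⟨f, rfl⟩ := haf
    -- The trace `a · u'` is the join of `u` and `a`; it is below both `a · v` and `a · f`, so
    -- cancelling `a` bounds `u'` by `v` and by `f`.
    have key : ∀ {u v : D.Trace}, u ≤ letter D a * v → u ≤ e →
        ∃ u', u ≤ letter D a * u' ∧ u' ≤ v ∧ u' ≤ f := by
      intro u v huv hue
      obtain ⟨g, hg, -⟩ := exists_isLUB_pair huv (le_mul (letter D a) v)
      obtain ⟨g, rfl⟩ : letter D a ≤ g := hg.1 (by simp)
      refine ⟨g, hg.1 (by simp), letter_mul_le.1 (hg.2 ?_), letter_mul_le.1 (hg.2 ?_)⟩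
      · rintro _ (rfl | rfl)
        exacts [huv, le_mul _ _]
      · rintro _ (rfl | rfl)
        exacts [hue.trans hef, le_mul _ _]
    obtain ⟨x', hx, hxp', hxf⟩ := key hxp hxe
    obtain ⟨y', hy, hyq', hyf⟩ := key hyq hye
    obtain ⟨z, h1, h2, h3⟩ := ih ⟨f, hxf, hyf⟩ ⟨p, hxp', hwp'⟩ ⟨q, hyq', hwq'⟩
    exact ⟨letter D a * z, hx.trans (letter_mul_le.2 h1), hy.trans (letter_mul_le.2 h2),
      letter_mul_le.2 h3⟩

/-- A finite set of pairwise compatible traces is compatible. -/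
theorem compatible_of_pairwise {S : Set D.Trace} (hS : S.Finite)
    (h : ∀ x ∈ S, ∀ y ∈ S, Compatible {x, y}) : Compatible S := by
  -- The induction needs the stronger claim that whatever is compatible with each member is
  -- compatible with the bound `z`; this lets the next member be joined to `z`.
  suffices ∃ z, (∀ x ∈ S, x ≤ z) ∧ ∀ w, (∀ x ∈ S, Compatible {w, x}) → Compatible {w, z} from
    ⟨this.choose, this.choose_spec.1⟩
  induction S, hS using Set.Finite.induction_on with
  | empty => exact ⟨1, by simp, fun w _ => compatible_pair.2 ⟨w, le_rfl, one_le w⟩⟩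
  | @insert x S _ _ ih =>
    obtain ⟨z, hz, hw⟩ := ih fun y hy y' hy' =>
      h y (Set.mem_insert_of_mem _ hy) y' (Set.mem_insert_of_mem _ hy')
    have hxz := hw x fun y hy => h x (Set.mem_insert _ _) y (Set.mem_insert_of_mem _ hy)
    obtain ⟨u, hxu, hzu⟩ := compatible_pair.1 hxz
    obtain ⟨e, he, -⟩ := exists_isLUB_pair hxu hzu
    refine ⟨e, ?_, fun w hwS => ?_⟩
    · rintro y (rfl | hy)
      · exact he.1 (by simp)
      · exact (hz y hy).trans (he.1 (by simp))
    · obtain ⟨v, h1, h2, h3⟩ := exists_upper_bound_of_pairwise hxz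
        (compatible_pair_comm.1 (hwS x (Set.mem_insert _ _)))
        (compatible_pair_comm.1 (hw w fun y hy => hwS y (Set.mem_insert_of_mem _ hy)))
      refine compatible_pair.2 ⟨v, h3, he.2 ?_⟩
      rintro _ (rfl | rfl)
      exacts [h1, h2]

end Trace

end SeqObject

/-! ## Candidates and outputs as functions of the views -/

namespace GCA

open SeqObject SeqObject.Trace

variable {Q O R : Type*} {D : SeqObject Q O R} {n : ℕ}

/-- The view `a'` contains all the entries of the view `a`. -/
def ViewLE {α : Type*} (a a' : Fin n → Option α) : Prop := ∀ k x, a k = some x → a' k = some x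

theorem ViewLE.refl {α : Type*} (a : Fin n → Option α) : ViewLE a a := fun _ _ h => h

theorem ViewLE.trans {α : Type*} {a b c : Fin n → Option α} (h : ViewLE a b) (h' : ViewLE b c) :
    ViewLE a c := fun k x hx => h' k x (h k x hx)

theorem entry_eq_of_chain {α : Type*} {a a' : Fin n → Option α} (h : ViewLE a a' ∨ ViewLE a' a)
    {k : Fin n} {x y : α} (hx : a k = some x) (hy : a' k = some y) : x = y := by
  rcases h with h | h
  · exact Option.some.inj ((h k x hx).symm.trans hy)
  · exact Option.some.inj (hx.symm.trans (h k y hy))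

/-- A finite non-empty set has a greatest element for a transitive relation that is total on it. -/
theorem exists_greatest {ι : Type*} (r : ι → ι → Prop) (htrans : ∀ i j k, r i j → r j k → r i k)
    {S : Set ι} (hS : S.Finite) (hne : S.Nonempty) (htot : ∀ i ∈ S, ∀ j ∈ S, r i j ∨ r j i) :
    ∃ m ∈ S, ∀ k ∈ S, r k m := by
  induction S, hS using Set.Finite.induction_on with
  | empty => exact absurd hne Set.not_nonempty_empty
  | @insert x S _ _ ih =>
    have hx : r x x := (or_self_iff).1 (htot x (Set.mem_insert _ _) x (Set.mem_insert _ _))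
    rcases S.eq_empty_or_nonempty with rfl | hne'
    · exact ⟨x, Set.mem_insert _ _, by rintro k (rfl | hk); exacts [hx, absurd hk (by simp)]⟩
    obtain ⟨m, hm, hmax⟩ := ih hne' fun i hi j hj =>
      htot i (Set.mem_insert_of_mem _ hi) j (Set.mem_insert_of_mem _ hj)
    rcases htot x (Set.mem_insert _ _) m (Set.mem_insert_of_mem _ hm) with h | h
    · exact ⟨m, Set.mem_insert_of_mem _ hm, by rintro k (rfl | hk); exacts [h, hmax k hk]⟩
    · refine ⟨x, Set.mem_insert _ _, ?_⟩
      rintro k (rfl | hk)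
      exacts [hx, htrans _ _ _ (hmax k hk) h]

/-- The traces in a view. -/
def entries (a : Fin n → Option D.Trace) : Set D.Trace := {x | ∃ k, a k = some x}

theorem entries_finite (a : Fin n → Option D.Trace) : (entries a).Finite :=
  show (some ⁻¹' Set.range a).Finite from (Set.finite_range a).preimage (Option.some_injective _).injOn

theorem entries_mono {a a' : Fin n → Option D.Trace} (h : ViewLE a a') : entries a ⊆ entries a' :=
  fun x ⟨k, hk⟩ => ⟨k, h k x hk⟩

/-! ### The vector `A^co` and the candidates -/

theorem co_eq_none {a : Fin n → Option D.Trace} {k : Fin n} (h : a k = none) : co a k = none := by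
  rw [co, glbBot, if_pos]
  exact Or.inl h.symm

/-- A `⊥` entry is compatible with every trace, so it never enters the set whose meet is taken; the
meet is `⊥` only if the entry `a k` itself is. -/
theorem co_eq_some {a : Fin n → Option D.Trace} {k : Fin n} {x : D.Trace} (h : a k = some x) :
    ∃ y, co a k = some y ∧
      IsGLB ({x} ∪ {z | ∃ j, a j = some z ∧ ¬ Compatible {z, x}}) y := by
  have hpair : ∀ z : D.Trace, proper {some z, some x} = {z, x} := by
    intro z; ext w; simp [proper]
  have hset : proper ({a k} ∪ {z | ∃ j, z = a j ∧ ¬ CompatibleBot {a j, a k}}) =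
      {x} ∪ {z | ∃ j, a j = some z ∧ ¬ Compatible {z, x}} := by
    ext z
    simp only [h, proper, Set.mem_union, Set.mem_singleton_iff, Set.mem_ofPred_eq,
      Option.some.injEq]
    refine or_congr_right (exists_congr fun j => ?_)
    constructor
    · rintro ⟨h1, h2⟩
      exact ⟨h1.symm, by rwa [← h1, CompatibleBot, hpair] at h2⟩
    · rintro ⟨h1, h2⟩
      exact ⟨h1.symm, by rwa [h1, CompatibleBot, hpair]⟩
  rw [co, glbBot, if_neg]
  · rw [hset]
    exact ⟨_, rfl, isGLB_glb ⟨x, Or.inl rfl⟩⟩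
  · rintro (h1 | ⟨j, h1, h2⟩)
    · exact absurd (h1.trans h) (by simp)
    · refine h2 ⟨x, fun z hz => ?_⟩
      rw [← h1, h] at hz
      have : z = x := by simpa [proper] using hz
      exact this.le

theorem of_co_eq_some {a : Fin n → Option D.Trace} {k : Fin n} {y : D.Trace}
    (h : co a k = some y) : ∃ x, a k = some x ∧
      IsGLB ({x} ∪ {z | ∃ j, a j = some z ∧ ¬ Compatible {z, x}}) y := by
  cases hx : a k with
  | none => rw [co_eq_none hx] at h; cases h
  | some x =>
    obtain ⟨y', hy, hg⟩ := co_eq_some hx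
    rw [h] at hy
    cases hy
    exact ⟨x, rfl, hg⟩

/-- Let `x`, `x'` be the raw entries above `y`, `y'`. If they are compatible, so are `y`, `y'`.
Otherwise the larger view `a'` contains `x` too, so `x` takes part in the meet `y'`, and both `y`
and `y'` are below `x`. -/
theorem co_compatible_of_le {a a' : Fin n → Option D.Trace} (h : ViewLE a a') {y y' : D.Trace}
    (hy : y ∈ entries (co a)) (hy' : y' ∈ entries (co a')) : Compatible {y, y'} := by
  obtain ⟨k, hk⟩ := hy
  obtain ⟨l, hl⟩ := hy'
  obtain ⟨x, hx, hg⟩ := of_co_eq_some hk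
  obtain ⟨x', hx', hg'⟩ := of_co_eq_some hl
  have hyx : y ≤ x := hg.1 (Or.inl rfl)
  by_cases hc : Compatible {x, x'}
  · exact hc.mono hyx (hg'.1 (Or.inl rfl))
  · exact compatible_pair.2 ⟨x, hyx, hg'.1 (Or.inr ⟨k, h k x hx, hc⟩)⟩

theorem compatible_co_union {a a' : Fin n → Option D.Trace} (h : ViewLE a a') :
    Compatible (entries (co a) ∪ entries (co a')) := by
  refine compatible_of_pairwise ((entries_finite _).union (entries_finite _)) ?_
  rintro x (hx | hx) y (hy | hy)
  · exact co_compatible_of_le (ViewLE.refl a) hx hy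
  · exact co_compatible_of_le h hx hy
  · exact compatible_pair_comm.1 (co_compatible_of_le h hy hx)
  · exact co_compatible_of_le (ViewLE.refl a') hx hy

theorem compatible_co (a : Fin n → Option D.Trace) : Compatible (entries (co a)) := by
  simpa using compatible_co_union (ViewLE.refl a)

theorem isLUB_candidate (a : Fin n → Option D.Trace) :
    IsLUB (entries (co a)) (candidate a).1 := isLUB_lub (compatible_co a)

theorem isLUB_candidate_of_true {a : Fin n → Option D.Trace} (h : (candidate a).2 = true) :
    IsLUB (entries a) (candidate a).1 := by
  have h1 : a = co a := by simpa [candidate] using h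
  have h2 := isLUB_candidate a
  rwa [← h1] at h2

theorem candidate_snd_of_compatible {a : Fin n → Option D.Trace} (h : Compatible (entries a)) :
    (candidate a).2 = true := by
  obtain ⟨z, hz⟩ := h
  have : a = co a := by
    funext k
    cases hx : a k with
    | none => rw [co_eq_none hx]
    | some x =>
      obtain ⟨y, hy, hg⟩ := co_eq_some hx
      rw [hy]
      congr 1
      refine le_antisymm (hg.2 ?_) (hg.1 (Or.inl rfl))
      rintro w (rfl | ⟨j, hj, hc⟩)
      · exact le_rfl
      · exact absurd (compatible_pair.2 ⟨z, hz w ⟨j, hj⟩, hz x ⟨k, hx⟩⟩) hc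
  simpa [candidate] using this

theorem le_candidate_of_true {a : Fin n → Option D.Trace} (h : (candidate a).2 = true) {k : Fin n}
    {x : D.Trace} (hx : a k = some x) : x ≤ (candidate a).1 :=
  (isLUB_candidate_of_true h).1 ⟨k, hx⟩

/-- Both flags matter: only then are the candidates joins of the raw views. In general, a larger
view may reveal incompatibilities that cut the candidate down. -/
theorem candidate_mono {a a' : Fin n → Option D.Trace} (h : ViewLE a a')
    (ha : (candidate a).2 = true) (ha' : (candidate a').2 = true) :
    (candidate a).1 ≤ (candidate a').1 :=
  (isLUB_candidate_of_true ha).2 fun _ ⟨k, hk⟩ => le_candidate_of_true ha' (h k _ hk)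

theorem candidate_compatible {a a' : Fin n → Option D.Trace} (h : ViewLE a a' ∨ ViewLE a' a) :
    Compatible {(candidate a).1, (candidate a').1} := by
  have key : ∀ {a a' : Fin n → Option D.Trace}, ViewLE a a' →
      Compatible {(candidate a).1, (candidate a').1} := by
    intro a a' h
    obtain ⟨z, hz⟩ := compatible_co_union h
    exact compatible_pair.2 ⟨z, (isLUB_candidate a).2 fun x hx => hz x (Or.inl hx),
      (isLUB_candidate a').2 fun x hx => hz x (Or.inr hx)⟩
  exact h.elim key fun h => compatible_pair_comm.1 (key h)

theorem ops_candidate_le {a : Fin n → Option D.Trace} {m : Multiset O}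
    (hm : ∀ x ∈ entries a, ops x ≤ m) : ops (candidate a).1 ≤ m := by
  refine ops_le_of_isLUB (isLUB_candidate a) ?_
  rintro y ⟨k, hk⟩
  obtain ⟨x, hx, hg⟩ := of_co_eq_some hk
  exact (ops_mono (hg.1 (Or.inl rfl))).trans (hm x ⟨k, hx⟩)

/-- A non-`⊥` entry is required, since the candidate of an empty view is the empty trace. -/
theorem le_candidate {a : Fin n → Option D.Trace} {g : D.Trace} (hg : g ∈ lowerBounds (entries a))
    {k : Fin n} (hk : a k ≠ none) : g ≤ (candidate a).1 := by
  obtain ⟨x, hx⟩ := Option.ne_none_iff_exists'.1 hk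
  obtain ⟨y, hy, hglb⟩ := co_eq_some hx
  refine le_trans (hglb.2 ?_) ((isLUB_candidate a).1 ⟨k, hy⟩)
  rintro w (rfl | ⟨j, hj, -⟩)
  exacts [hg ⟨k, hx⟩, hg ⟨j, hj⟩]

theorem candidate_of_eq {a : Fin n → Option D.Trace} {s : D.Trace} (hs : ∀ x ∈ entries a, x = s)
    {k : Fin n} (hk : a k ≠ none) : candidate a = (s, true) := by
  have h : (candidate a).2 = true :=
    candidate_snd_of_compatible ⟨s, fun x hx => (hs x hx).le⟩
  refine Prod.ext (le_antisymm ?_ ?_) h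
  · exact (isLUB_candidate_of_true h).2 fun x hx => (hs x hx).le
  · exact le_candidate (fun x hx => (hs x hx).ge) hk

/-! ### Bounds on the output trace -/

theorem isGLB_outTrace {b : Fin n → Option (D.Trace × Bool)} {j : Fin n} {x : D.Trace}
    (h : b j = some (x, true)) (i : Fin n) :
    IsGLB {x | ∃ k, b k = some (x, true)} (outTrace i b) := by
  rw [outTrace, if_pos ⟨j, x, h⟩]
  exact isGLB_glb ⟨x, j, h⟩

theorem outTrace_of_not {b : Fin n → Option (D.Trace × Bool)}
    (h : ¬ ∃ j x, b j = some (x, true)) {i : Fin n} {p : D.Trace × Bool} (hi : b i = some p) :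
    outTrace i b = p.1 := by
  rw [outTrace, if_neg h, hi]
  rfl

/-- With `le_outTrace`, this bounds the output from both sides by the candidates seen, without
regard to whether a True flag was among them. -/
theorem exists_outTrace_le {b : Fin n → Option (D.Trace × Bool)} {i : Fin n}
    {p : D.Trace × Bool} (hi : b i = some p) : ∃ k q, b k = some q ∧ outTrace i b ≤ q.1 := by
  by_cases h : ∃ j x, b j = some (x, true)
  · obtain ⟨j, x, h⟩ := h
    exact ⟨j, _, h, (isGLB_outTrace h i).1 ⟨j, h⟩⟩
  · exact ⟨i, p, hi, (outTrace_of_not h hi).le⟩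

theorem le_outTrace {b : Fin n → Option (D.Trace × Bool)} {i : Fin n}
    {p : D.Trace × Bool} (hi : b i = some p) {g : D.Trace} (hg : ∀ k q, b k = some q → g ≤ q.1) :
    g ≤ outTrace i b := by
  by_cases h : ∃ j x, b j = some (x, true)
  · obtain ⟨j, x, h⟩ := h
    refine (isGLB_outTrace h i).2 ?_
    rintro y ⟨k, hk⟩
    exact hg k _ hk
  · rw [outTrace_of_not h hi]
    exact hg i p hi

theorem outFlag_eq_true {i : Fin n} {s : D.Trace} {a : Fin n → Option D.Trace}
    {b : Fin n → Option (D.Trace × Bool)} : outFlag i s a b = true ↔ WeakFlag s a b ∨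
      ((∀ k x, a k = some x → x ≤ outTrace i b → b k ≠ none) ∧ ¬ ∃ k x, b k = some (x, false)) := by
  simp only [outFlag, decide_eq_true_iff]

/-! ## Safety from the order of the views -/

/-- What an execution with inputs `inp` and outputs `out` guarantees about the sets `𝒜` and `ℬ` of
the successive contents of the two snapshot objects. -/
structure ViewHistory (inp : Fin n → Option D.Trace) (out : Fin n → Option (D.Trace × Bool))
    (𝒜 : Set (Fin n → Option D.Trace)) (ℬ : Set (Fin n → Option (D.Trace × Bool))) : Prop where
  chainA : ∀ a ∈ 𝒜, ∀ a' ∈ 𝒜, ViewLE a a' ∨ ViewLE a' a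
  chainB : ∀ b ∈ ℬ, ∀ b' ∈ ℬ, ViewLE b b' ∨ ViewLE b' b
  le_inp : ∀ a ∈ 𝒜, ViewLE a inp
  exists_view : ∀ b ∈ ℬ, ∀ k p, b k = some p → ∃ a ∈ 𝒜, a k ≠ none ∧ p = candidate a
  returns : ∀ i t c, out i = some (t, c) → ∃ s, inp i = some s ∧ ∃ a ∈ 𝒜, a i = some s ∧
    ∃ b ∈ ℬ, b i = some (candidate a) ∧ t = outTrace i b ∧ c = outFlag i s a b

namespace ViewHistory

variable {inp : Fin n → Option D.Trace} {out : Fin n → Option (D.Trace × Bool)}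
  {𝒜 : Set (Fin n → Option D.Trace)} {ℬ : Set (Fin n → Option (D.Trace × Bool))}

theorem exists_candidate (H : ViewHistory inp out 𝒜 ℬ) {i : Fin n} {t : D.Trace} {c : Bool}
    (h : out i = some (t, c)) : ∃ a ∈ 𝒜, t ≤ (candidate a).1 := by
  obtain ⟨s, -, a, -, -, b, hb, hbi, rfl, -⟩ := H.returns i t c h
  obtain ⟨k, q, hq, hle⟩ := exists_outTrace_le hbi
  obtain ⟨a', ha', -, rfl⟩ := H.exists_view b hb k q hq
  exact ⟨a', ha', hle⟩

theorem validity (H : ViewHistory inp out 𝒜 ℬ) {i : Fin n} {t : D.Trace} {c : Bool}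
    (h : out i = some (t, c)) {m : Multiset O} (hm : ∀ j s, inp j = some s → ops s ≤ m) :
    ops t ≤ m := by
  obtain ⟨a, ha, hle⟩ := H.exists_candidate h
  refine (ops_mono hle).trans (ops_candidate_le ?_)
  rintro x ⟨k, hk⟩
  exact hm k x (H.le_inp a ha k x hk)

theorem convergence (H : ViewHistory inp out 𝒜 ℬ) :
    Compatible {t | ∃ i c, out i = some (t, c)} := by
  refine compatible_of_pairwise ?_ ?_
  · refine (entries_finite fun i => (out i).map Prod.fst).subset ?_
    rintro t ⟨i, c, h⟩
    exact ⟨i, by simp [h]⟩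
  · rintro t ⟨i, c, h⟩ t' ⟨i', c', h'⟩
    obtain ⟨a, ha, hle⟩ := H.exists_candidate h
    obtain ⟨a', ha', hle'⟩ := H.exists_candidate h'
    exact (candidate_compatible (H.chainA a ha a' ha')).mono hle hle'

theorem commonPrefix (H : ViewHistory inp out 𝒜 ℬ) {i : Fin n} {t : D.Trace} {c : Bool}
    (h : out i = some (t, c)) {g : D.Trace} (hg : g ∈ lowerBounds (entries inp)) : g ≤ t := by
  obtain ⟨s, -, a, -, -, b, hb, hbi, rfl, -⟩ := H.returns i t c h
  refine le_outTrace hbi fun k q hq => ?_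
  obtain ⟨a', ha', hk, rfl⟩ := H.exists_view b hb k q hq
  exact le_candidate (fun x hx => hg (entries_mono (H.le_inp a' ha') hx)) hk

theorem weakAgreement (H : ViewHistory inp out 𝒜 ℬ)
    (heq : ∀ i j s s', inp i = some s → inp j = some s' → s = s') {i : Fin n} {t : D.Trace}
    {c : Bool} (h : out i = some (t, c)) : c = true := by
  obtain ⟨s, hs, a, ha, -, b, hb, -, -, rfl⟩ := H.returns i t c h
  have key : ∀ a ∈ 𝒜, ∀ x ∈ entries a, x = s := by
    rintro a ha x ⟨k, hk⟩
    exact heq k i x s (H.le_inp a ha k x hk) hs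
  refine outFlag_eq_true.2 (Or.inl ⟨fun k x hk => key a ha x ⟨k, hk⟩, fun k x c hk => ?_⟩)
  obtain ⟨a', ha', hk', hp⟩ := H.exists_view b hb k _ hk
  rw [candidate_of_eq (key a' ha') hk'] at hp
  exact congrArg Prod.fst hp

theorem adoption_of_weakFlag (H : ViewHistory inp out 𝒜 ℬ) {i j : Fin n} {s : D.Trace}
    {a a' : Fin n → Option D.Trace} {b b' : Fin n → Option (D.Trace × Bool)} (ha : a ∈ 𝒜)
    (hai : a i = some s) (hb : b ∈ ℬ) (hbi : b i = some (candidate a)) (hb' : b' ∈ ℬ)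
    (hbj : b' j = some (candidate a'))
    (hw : WeakFlag s a b) : outTrace i b ≤ outTrace j b' := by
  have hs : ∀ x ∈ entries a, x = s := fun x ⟨k, hk⟩ => hw.1 k x hk
  have hcand : candidate a = (s, true) := candidate_of_eq hs (k := i) (by simp [hai])
  rw [hcand] at hbi
  refine ((isGLB_outTrace hbi i).1 ⟨i, hbi⟩).trans ?_
  by_cases h : ∃ l x, b' l = some (x, true)
  · obtain ⟨l, x, h⟩ := h
    refine (isGLB_outTrace h j).2 ?_
    rintro y ⟨k, hk⟩
    obtain ⟨e, he, hek, hp⟩ := H.exists_view b' hb' k _ hk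
    obtain ⟨rfl, htrue⟩ := Prod.ext_iff.1 hp
    -- A view `e` above `a` contains `s` in entry `i`; a view below `a` contains no other trace than
    -- `s`. Either way its True candidate is at least `s`.
    rcases H.chainA a ha e he with hle | hle
    · exact le_candidate_of_true htrue.symm (hle i s hai)
    · rw [candidate_of_eq (fun x hx => hs x (entries_mono hle hx)) hek]
  · rw [outTrace_of_not h hbj]
    -- Without a True flag, `b'` lacks the entry of `i`, so it is the smaller view. Then `b`
    -- contains the candidate of `j`, which the weak flag makes equal to `s`.
    rcases H.chainB b hb b' hb' with hle | hle
    · exact absurd ⟨i, s, hle i _ hbi⟩ h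
    · exact (hw.2 j (candidate a').1 (candidate a').2 (hle j _ hbj)).ge

/-- All candidates in `b` are True and hence ordered like their views, so the output of `i` is the
candidate of the least such view. A True candidate seen by `j` either comes from a larger view, or
from a smaller one and is then already in `b`. -/
theorem adoption_of_strongFlag (H : ViewHistory inp out 𝒜 ℬ) {i j : Fin n}
    {a a' : Fin n → Option D.Trace} {b b' : Fin n → Option (D.Trace × Bool)} (ha : a ∈ 𝒜)
    (hb : b ∈ ℬ) (hbi : b i = some (candidate a)) (hb' : b' ∈ ℬ)
    (hbj : b' j = some (candidate a'))
    (hcov : ∀ k x, a k = some x → x ≤ outTrace i b → b k ≠ none)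
    (hnf : ¬ ∃ k x, b k = some (x, false)) : outTrace i b ≤ outTrace j b' := by
  have htrue : ∀ k p, b k = some p → p.2 = true := by
    intro k p hk
    by_contra hp
    rw [Bool.not_eq_true] at hp
    exact hnf ⟨k, p.1, by rw [hk, ← hp]⟩
  -- the least view among those that the candidates in `b` come from
  let S : Set (Fin n) := {k | b k ≠ none}
  -- For `k = i` the view is chosen to be `a` itself, as the history might supply another view with
  -- the same candidate; this makes the least view a subview of `a`, the view tested by the coverage
  -- condition.
  have hf : ∀ k, ∃ e ∈ 𝒜, (∀ p, b k = some p → p = candidate e) ∧ (k = i → e = a) := by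
    intro k
    rcases eq_or_ne k i with rfl | hk
    · refine ⟨a, ha, fun p hp => ?_, fun _ => rfl⟩
      rw [hbi] at hp
      exact (Option.some.inj hp).symm
    · cases hbk : b k with
      | none => exact ⟨a, ha, by simp, fun _ => rfl⟩
      | some p =>
        obtain ⟨e, he, -, rfl⟩ := H.exists_view b hb k p hbk
        exact ⟨e, he, by rintro _ ⟨⟩; rfl, fun h => absurd h hk⟩
  choose f hfA hfb hfi using hf
  obtain ⟨m, hm, hmin⟩ := exists_greatest (fun k l => ViewLE (f l) (f k))
    (fun _ _ _ h h' => h'.trans h) (Set.toFinite S) ⟨i, by simp [S, hbi]⟩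
    (fun k _ l _ => (H.chainA _ (hfA l) _ (hfA k)))
  obtain ⟨p, hp⟩ := Option.ne_none_iff_exists'.1 hm
  have hpm := hfb m p hp
  subst hpm
  have hmtrue := htrue m _ hp
  have hle_m : outTrace i b ≤ (candidate (f m)).1 :=
    (isGLB_outTrace (hp.trans (by rw [← hmtrue])) i).1 ⟨m, hp.trans (by rw [← hmtrue])⟩
  have hm_le : (candidate (f m)).1 ≤ outTrace i b := by
    refine le_outTrace hbi fun k q hq => ?_
    have hqf := hfb k q hq
    subst hqf
    exact candidate_mono (hmin k (by simp [S, hq])) hmtrue (htrue k _ hq)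
  have hma : ViewLE (f m) a := by
    have := hmin i (by simp [S, hbi])
    rwa [hfi i rfl] at this
  -- The views `b` and `b'` are comparable, so either `j` sees the True candidate of `i`, or `i`
  -- sees that of `j`, which is then True.
  have hex : ∃ l x, b' l = some (x, true) := by
    rcases H.chainB b hb b' hb' with hle | hle
    · exact ⟨i, (candidate a).1, by rw [hle i _ hbi, ← htrue i _ hbi]⟩
    · exact ⟨j, (candidate a').1, by rw [hbj, ← htrue j _ (hle j _ hbj)]⟩
  obtain ⟨l, x, hl⟩ := hex
  refine (isGLB_outTrace hl j).2 ?_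
  rintro y ⟨k, hk⟩
  obtain ⟨e, he, hek, hpe⟩ := H.exists_view b' hb' k _ hk
  obtain ⟨rfl, hetrue⟩ := Prod.ext_iff.1 hpe
  rcases H.chainA _ (hfA m) e he with hle | hle
  · exact hle_m.trans (candidate_mono hle hmtrue hetrue.symm)
  -- The author `k` of this candidate has its input `u` in `e`, hence in `f m` and in `a`, and `u`
  -- is below the output of `i`. Coverage puts its candidate into `b`, so it belongs to the meet
  -- computed by `i`.
  · obtain ⟨u, hu⟩ := Option.ne_none_iff_exists'.1 hek
    have hum := hle k u hu
    have hbk := hcov k u (hma k u hum) ((le_candidate_of_true hmtrue hum).trans hm_le)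
    obtain ⟨q, hq⟩ := Option.ne_none_iff_exists'.1 hbk
    have := entry_eq_of_chain (H.chainB b hb b' hb') hq hk
    subst this
    exact (isGLB_outTrace hq i).1 ⟨k, hq⟩

theorem adoption (H : ViewHistory inp out 𝒜 ℬ) {i j : Fin n} {t t' : D.Trace} {c' : Bool}
    (h : out i = some (t, true)) (h' : out j = some (t', c')) : t ≤ t' := by
  obtain ⟨s, -, a, ha, hai, b, hb, hbi, rfl, hc⟩ := H.returns i t true h
  obtain ⟨-, -, a', -, -, b', hb', hbj, rfl, -⟩ := H.returns j t' c' h'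
  rcases outFlag_eq_true.1 hc.symm with hw | ⟨hcov, hnf⟩
  · exact H.adoption_of_weakFlag ha hai hb hbi hb' hbj hw
  · exact H.adoption_of_strongFlag ha hb hbi hb' hbj hcov hnf

/-- Process `m` has the least candidate, and `j` has the last view of `B` among the processes with
input below that candidate. As `m` qualifies, `j` sees its candidate and outputs exactly that trace;
every input tested by coverage belongs to a qualifying process, whose entry `j` sees. -/
theorem commitment (H : ViewHistory inp out 𝒜 ℬ) (hne : ∃ i, inp i ≠ none)
    (hcomp : Compatible (entries inp)) (hret : ∀ i, inp i ≠ none → out i ≠ none) :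
    ∃ j s t, inp j = some s ∧ out j = some (t, true) ∧ s ≤ t := by
  have htrue : ∀ a ∈ 𝒜, (candidate a).2 = true := fun a ha => by
    obtain ⟨z, hz⟩ := hcomp
    exact candidate_snd_of_compatible ⟨z, fun x hx => hz x (entries_mono (H.le_inp a ha) hx)⟩
  let P : Set (Fin n) := {i | inp i ≠ none}
  have hP : ∀ i : P, ∃ s a b, inp i = some s ∧ a ∈ 𝒜 ∧ a i = some s ∧ b ∈ ℬ ∧
      b i = some (candidate a) ∧ out i = some (outTrace i b, outFlag i s a b) := by
    rintro ⟨i, hi⟩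
    obtain ⟨⟨t, c⟩, ho⟩ := Option.ne_none_iff_exists'.1 (hret i hi)
    obtain ⟨s, hs, a, ha, hai, b, hb, hbi, rfl, rfl⟩ := H.returns i t c ho
    exact ⟨s, a, b, hs, ha, hai, hb, hbi, ho⟩
  choose s a b hs ha hai hb hbi ho using hP
  obtain ⟨i₀, hi₀⟩ := hne
  -- the least candidate
  obtain ⟨m, -, hmin⟩ := exists_greatest
    (fun k l : P => (candidate (a l)).1 ≤ (candidate (a k)).1)
    (fun _ _ _ h h' => h'.trans h) Set.finite_univ ⟨⟨i₀, hi₀⟩, trivial⟩ (fun k _ l _ =>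
      (H.chainA _ (ha l) _ (ha k)).imp (fun h => candidate_mono h (htrue _ (ha l)) (htrue _ (ha k)))
        (fun h => candidate_mono h (htrue _ (ha k)) (htrue _ (ha l))))
  -- the last view of a process whose input is below it
  obtain ⟨j, hj, hmax⟩ := exists_greatest (fun k l : P => ViewLE (b k) (b l))
    (fun _ _ _ h h' => h.trans h')
    (Set.toFinite {k : P | s k ≤ (candidate (a m)).1})
    ⟨m, le_candidate_of_true (htrue _ (ha m)) (hai m)⟩
    (fun k _ l _ => H.chainB _ (hb k) _ (hb l))
  have hbm : b j m = some (candidate (a m)) :=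
    hmax m (le_candidate_of_true (htrue _ (ha m)) (hai m)) m _ (hbi m)
  have hbm' : b j m = some ((candidate (a m)).1, true) := by
    rw [hbm, ← htrue _ (ha m)]
  have hle : outTrace j (b j) ≤ (candidate (a m)).1 := (isGLB_outTrace hbm' j).1 ⟨m, hbm'⟩
  have hge : (candidate (a m)).1 ≤ outTrace j (b j) := by
    refine le_outTrace (hbi j) fun k q hq => ?_
    obtain ⟨e, he, hek, -⟩ := H.exists_view _ (hb j) k q hq
    obtain ⟨x, hx⟩ := Option.ne_none_iff_exists'.1 hek
    have hkP : inp k ≠ none := by rw [H.le_inp e he k x hx]; simp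
    -- Since every participant returns, `k` has a view `b k` holding its own candidate, and an entry
    -- of `B` has the same value in all views where it is present.
    have := entry_eq_of_chain (H.chainB _ (hb j) _ (hb ⟨k, hkP⟩)) hq (hbi ⟨k, hkP⟩)
    subst this
    exact hmin ⟨k, hkP⟩ trivial
  refine ⟨j, s j, outTrace j (b j), hs j, ?_, le_trans hj hge⟩
  rw [ho j]
  congr 2
  refine outFlag_eq_true.2 (Or.inr ⟨fun k x hx hxle => ?_, ?_⟩)
  · have hinp := H.le_inp _ (ha j) k x hx
    have hkP : inp k ≠ none := by rw [hinp]; simp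
    have hsk : s ⟨k, hkP⟩ = x := Option.some.inj ((hs ⟨k, hkP⟩).symm.trans hinp)
    have hk : s ⟨k, hkP⟩ ≤ (candidate (a m)).1 := by rw [hsk]; exact hxle.trans hle
    rw [hmax ⟨k, hkP⟩ hk k _ (hbi ⟨k, hkP⟩)]
    simp
  · rintro ⟨k, x, hk⟩
    obtain ⟨e, he, -, hp⟩ := H.exists_view _ (hb j) k _ hk
    have := htrue e he
    rw [← hp] at this
    cases this

open Classical in
theorem gcaSpec (H : ViewHistory inp out 𝒜 ℬ) : GCASpec inp out where
  returns_of_participant i hi := by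
    obtain ⟨⟨t, c⟩, h⟩ := Option.ne_none_iff_exists'.1 hi
    obtain ⟨s, hs, -⟩ := H.returns i t c h
    simp [hs]
  validity i t c h := H.validity h fun j s hs => by
    have := Finset.le_sup (f := fun j => (inp j).elim (0 : Multiset O) ops) (Finset.mem_univ j)
    simpa only [hs, Option.elim_some] using this
  adoption _ _ h _ _ _ h' := H.adoption h h'
  commitment h1 h2 h3 := H.commitment h1 (by simpa only [entries, eq_comm] using h2) h3
  convergence := H.convergence
  commonPrefix i t c h := by
    obtain ⟨s, hs, -⟩ := H.returns i t c h
    obtain ⟨g, hg⟩ := exists_isGLB (S := entries inp) ⟨s, i, hs⟩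
    exact ⟨g, hg, H.commonPrefix h hg.1⟩
  weakAgreement heq _ _ _ h := H.weakAgreement heq h

end ViewHistory

end GCA

/-! ## Executions -/

namespace GCA

open SeqObject SeqObject.Trace

variable {Q O R : Type*} {D : SeqObject Q O R} {n : ℕ}

theorem ViewLE.update {α : Type*} {a : Fin n → Option α} {i : Fin n} (h : a i = none)
    (v : Option α) : ViewLE a (Function.update a i v) := by
  intro k x hk
  rw [Function.update_of_ne]
  · exact hk
  · rintro rfl
    rw [h] at hk
    cases hk

/-- The own entries `A` and `B` of process `i` in its local state, when the contents that the two
snapshot objects have had so far are `𝒜` and `ℬ`. -/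
def LocalInv (𝒜 : Set (Fin n → Option D.Trace)) (ℬ : Set (Fin n → Option (D.Trace × Bool)))
    (i : Fin n) (A : Option D.Trace) (B : Option (D.Trace × Bool)) : Local D n → Prop
  | .idle => A = none ∧ B = none
  | .writeA _ => A = none ∧ B = none
  | .snapA s => A = some s ∧ B = none
  | .writeB s a => A = some s ∧ B = none ∧ a ∈ 𝒜 ∧ a i = some s
  | .snapB s a => A = some s ∧ B = some (candidate a) ∧ a ∈ 𝒜 ∧ a i = some s
  | .respond s a b => A = some s ∧ B = some (candidate a) ∧ a ∈ 𝒜 ∧ a i = some s ∧ b ∈ ℬ ∧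
      b i = some (candidate a)
  | .done s t c => A = some s ∧ ∃ a b, B = some (candidate a) ∧ a ∈ 𝒜 ∧ a i = some s ∧ b ∈ ℬ ∧
      b i = some (candidate a) ∧ t = outTrace i b ∧ c = outFlag i s a b

section LocalInv

variable {𝒜 : Set (Fin n → Option D.Trace)} {ℬ : Set (Fin n → Option (D.Trace × Bool))}
  {i : Fin n} {A : Option D.Trace} {B : Option (D.Trace × Bool)} {l : Local D n}

theorem LocalInv.input_of_some (h : LocalInv 𝒜 ℬ i A B l) {s : D.Trace} (hA : A = some s) :
    l.input = some s := by
  cases l <;> simp_all [LocalInv, Local.input]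

theorem LocalInv.exists_of_some (h : LocalInv 𝒜 ℬ i A B l) {p : D.Trace × Bool}
    (hB : B = some p) : ∃ a ∈ 𝒜, a i ≠ none ∧ p = candidate a := by
  subst hB
  cases l with
  | idle => exact absurd h.2 (by simp)
  | writeA s => exact absurd h.2 (by simp)
  | snapA s => exact absurd h.2 (by simp)
  | writeB s a => exact absurd h.2.1 (by simp)
  | snapB s a => exact ⟨a, h.2.2.1, by simp [h.2.2.2], Option.some.inj h.2.1⟩
  | respond s a b => exact ⟨a, h.2.2.1, by simp [h.2.2.2.1], Option.some.inj h.2.1⟩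
  | done s t c =>
    obtain ⟨-, a, b, hB, ha, hai, -⟩ := h
    exact ⟨a, ha, by simp [hai], Option.some.inj hB⟩

end LocalInv

/-! ### Preservation of the invariant and growth of the objects -/

namespace Config

/-- The local invariant of all the processes. -/
def Inv (𝒜 : Set (Fin n → Option D.Trace)) (ℬ : Set (Fin n → Option (D.Trace × Bool)))
    (C : Config D n) : Prop := ∀ i, LocalInv 𝒜 ℬ i (C.A i) (C.B i) (C.loc i)

variable {𝒜 : Set (Fin n → Option D.Trace)} {ℬ : Set (Fin n → Option (D.Trace × Bool))}
  {C : Config D n}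

/-- The sets of contents stay fixed and need only contain the current ones, so recorded views never
have to be transported to a longer history. A snapshot includes the own entry because the invariant
says that it has been written. -/
theorem Inv.next (h : C.Inv 𝒜 ℬ) (hA : C.A ∈ 𝒜) (hB : C.B ∈ ℬ) (ev : Event D n) :
    (C.next ev).Inv 𝒜 ℬ := by
  intro j
  cases ev with
  | invoke i s =>
    have hi := h i
    rcases eq_or_ne j i with rfl | hji
    · cases hl : C.loc j <;> simp_all [Config.next, LocalInv]
    · have hj := h j
      cases hl : C.loc i <;> simp_all [Config.next]
  | step i =>
    have hi := h i
    rcases eq_or_ne j i with rfl | hji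
    · cases hl : C.loc j with
      | respond s a b =>
        simp only [hl, LocalInv] at hi
        simp only [Config.next, hl, LocalInv, Function.update_self]
        exact ⟨hi.1, a, b, hi.2.1, hi.2.2.1, hi.2.2.2.1, hi.2.2.2.2.1, hi.2.2.2.2.2, rfl, rfl⟩
      | _ => simp_all [Config.next, LocalInv]
    · have hj := h j
      cases hl : C.loc i <;> simp_all [Config.next]

theorem Inv.le_A_next (h : C.Inv 𝒜 ℬ) (ev : Event D n) : ViewLE C.A (C.next ev).A := by
  cases ev with
  | invoke i s =>
    cases hl : C.loc i <;> simp only [Config.next, hl] <;> exact ViewLE.refl _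
  | step i =>
    have hi := h i
    cases hl : C.loc i <;> simp only [Config.next, hl] <;> try exact ViewLE.refl _
    rw [hl] at hi
    exact ViewLE.update hi.1 _

theorem Inv.le_B_next (h : C.Inv 𝒜 ℬ) (ev : Event D n) : ViewLE C.B (C.next ev).B := by
  cases ev with
  | invoke i s =>
    cases hl : C.loc i <;> simp only [Config.next, hl] <;> exact ViewLE.refl _
  | step i =>
    have hi := h i
    cases hl : C.loc i <;> simp only [Config.next, hl] <;> try exact ViewLE.refl _
    rw [hl] at hi
    exact ViewLE.update hi.2.1 _

theorem input_next (C : Config D n) (ev : Event D n) :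
    ViewLE (fun i => (C.loc i).input) fun i => ((C.next ev).loc i).input := by
  intro j s hj
  cases ev with
  | invoke i s =>
    rcases eq_or_ne j i with rfl | hji
    · cases hl : C.loc j <;> simp_all [Config.next, Local.input]
    · cases hl : C.loc i <;> simp_all [Config.next]
  | step i =>
    rcases eq_or_ne j i with rfl | hji
    · cases hl : C.loc j <;> simp_all [Config.next, Local.input]
    · cases hl : C.loc i <;> simp_all [Config.next]

theorem output_next (C : Config D n) (ev : Event D n) :
    ViewLE (fun i => (C.loc i).output) fun i => ((C.next ev).loc i).output := by
  intro j s hj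
  cases ev with
  | invoke i s =>
    rcases eq_or_ne j i with rfl | hji
    · cases hl : C.loc j <;> simp_all [Config.next, Local.output]
    · cases hl : C.loc i <;> simp_all [Config.next]
  | step i =>
    rcases eq_or_ne j i with rfl | hji
    · cases hl : C.loc j <;> simp_all [Config.next, Local.output]
    · cases hl : C.loc i <;> simp_all [Config.next]

end Config

/-- The number of steps that an invoked process still has to take. -/
def Local.remaining : Local D n → ℕ
  | .idle => 6
  | .writeA _ => 5
  | .snapA _ => 4
  | .writeB _ _ => 3
  | .snapB _ _ => 2
  | .respond _ _ _ => 1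
  | .done _ _ _ => 0

theorem Local.output_ne_none_of_remaining {l : Local D n} (h : l.remaining = 0) :
    l.output ≠ none := by
  cases l <;> simp_all [Local.remaining, Local.output]

theorem Local.remaining_le_five {l : Local D n} : l.remaining ≤ 5 ↔ l.input ≠ none := by
  cases l <;> simp [Local.remaining, Local.input]

theorem Config.remaining_next_le (C : Config D n) (ev : Event D n) (j : Fin n) :
    ((C.next ev).loc j).remaining ≤ (C.loc j).remaining := by
  cases ev with
  | invoke i s =>
    rcases eq_or_ne j i with rfl | hji
    · cases hl : C.loc j <;> simp [Config.next, hl, Local.remaining]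
    · cases hl : C.loc i <;> simp [Config.next, hl, hji]
  | step i =>
    rcases eq_or_ne j i with rfl | hji
    · cases hl : C.loc j <;> simp [Config.next, hl, Local.remaining]
    · cases hl : C.loc i <;> simp [Config.next, hl, hji]

/-- The bound 5 excludes the idle state, where a step does nothing; truncated subtraction covers a
process that has already returned. -/
theorem Config.remaining_next_step_le (C : Config D n) (i : Fin n)
    (h : (C.loc i).remaining ≤ 5) :
    ((C.next (.step i)).loc i).remaining ≤ (C.loc i).remaining - 1 := by
  cases hl : C.loc i <;> simp_all [Config.next, Local.remaining]

/-! ### Runs and their outcomes -/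

namespace Execution

variable (e : Execution D n)

theorem run_succ_of_none {τ : ℕ} (h : e τ = none) : e.run (τ + 1) = e.run τ := by
  rw [run, h]; rfl

theorem run_succ_of_some {τ : ℕ} {ev : Event D n} (h : e τ = some ev) :
    e.run (τ + 1) = (e.run τ).next ev := by
  rw [run, h]; rfl

theorem viewLE_of_le {α : Type*} {f : ℕ → Fin n → Option α} (hf : ∀ τ, ViewLE (f τ) (f (τ + 1)))
    {τ τ' : ℕ} (h : τ ≤ τ') : ViewLE (f τ) (f τ') := by
  induction h with
  | refl => exact ViewLE.refl _
  | step _ ih => exact ih.trans (hf _)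

theorem viewLE_total {α : Type*} {f : ℕ → Fin n → Option α} (hf : ∀ τ, ViewLE (f τ) (f (τ + 1)))
    (τ τ' : ℕ) : ViewLE (f τ) (f τ') ∨ ViewLE (f τ') (f τ) :=
  (le_total τ τ').imp (viewLE_of_le hf) (viewLE_of_le hf)

/-- Along a growing sequence an entry takes at most one value other than `none`, so an infinite
execution also has well-defined inputs and outputs. -/
theorem exists_limit {α : Type*} {f : ℕ → Fin n → Option α}
    (hf : ∀ τ, ViewLE (f τ) (f (τ + 1))) :
    ∃ g : Fin n → Option α, ∀ i x, g i = some x ↔ ∃ τ, f τ i = some x := by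
  have : ∀ i, ∃ y : Option α, ∀ x, y = some x ↔ ∃ τ, f τ i = some x := by
    intro i
    by_cases h : ∃ x τ, f τ i = some x
    · obtain ⟨x, τ, h⟩ := h
      refine ⟨some x, fun y => ⟨?_, ?_⟩⟩
      · rintro ⟨⟩
        exact ⟨τ, h⟩
      · rintro ⟨τ', h'⟩
        rw [entry_eq_of_chain (viewLE_total hf τ τ') h h']
    · refine ⟨none, fun y => ⟨by simp, ?_⟩⟩
      rintro ⟨τ, hτ⟩
      exact absurd ⟨y, τ, hτ⟩ h
  choose g hg using this
  exact ⟨g, hg⟩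

theorem inv_run (τ : ℕ) : (e.run τ).Inv (Set.range fun τ => (e.run τ).A)
    (Set.range fun τ => (e.run τ).B) := by
  induction τ with
  | zero => exact fun i => ⟨rfl, rfl⟩
  | succ τ ih =>
    cases h : e τ with
    | none => rwa [run_succ_of_none e h]
    | some ev =>
      rw [run_succ_of_some e h]
      exact ih.next ⟨τ, rfl⟩ ⟨τ, rfl⟩ ev

theorem A_succ (τ : ℕ) : ViewLE (e.run τ).A (e.run (τ + 1)).A := by
  cases h : e τ with
  | none => rw [run_succ_of_none e h]; exact ViewLE.refl _
  | some ev => rw [run_succ_of_some e h]; exact (e.inv_run τ).le_A_next ev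

theorem B_succ (τ : ℕ) : ViewLE (e.run τ).B (e.run (τ + 1)).B := by
  cases h : e τ with
  | none => rw [run_succ_of_none e h]; exact ViewLE.refl _
  | some ev => rw [run_succ_of_some e h]; exact (e.inv_run τ).le_B_next ev

theorem input_succ (τ : ℕ) : ViewLE (fun i => ((e.run τ).loc i).input)
    fun i => ((e.run (τ + 1)).loc i).input := by
  cases h : e τ with
  | none => rw [run_succ_of_none e h]; exact ViewLE.refl _
  | some ev => rw [run_succ_of_some e h]; exact (e.run τ).input_next ev

theorem output_succ (τ : ℕ) : ViewLE (fun i => ((e.run τ).loc i).output)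
    fun i => ((e.run (τ + 1)).loc i).output := by
  cases h : e τ with
  | none => rw [run_succ_of_none e h]; exact ViewLE.refl _
  | some ev => rw [run_succ_of_some e h]; exact (e.run τ).output_next ev

theorem exists_hasOutcome : ∃ inp out, e.HasOutcome inp out := by
  obtain ⟨inp, hinp⟩ := exists_limit e.input_succ
  obtain ⟨out, hout⟩ := exists_limit e.output_succ
  exact ⟨inp, out, hinp, hout⟩

theorem HasOutcome.viewHistory {e : Execution D n} {inp : Fin n → Option D.Trace}
    {out : Fin n → Option (D.Trace × Bool)} (h : e.HasOutcome inp out) :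
    ViewHistory inp out (Set.range fun τ => (e.run τ).A) (Set.range fun τ => (e.run τ).B) where
  chainA := by
    rintro _ ⟨τ, rfl⟩ _ ⟨τ', rfl⟩
    exact viewLE_total e.A_succ τ τ'
  chainB := by
    rintro _ ⟨τ, rfl⟩ _ ⟨τ', rfl⟩
    exact viewLE_total e.B_succ τ τ'
  le_inp := by
    rintro _ ⟨τ, rfl⟩ i s hs
    exact (h.1 i s).2 ⟨τ, (e.inv_run τ i).input_of_some hs⟩
  exists_view := by
    rintro _ ⟨τ, rfl⟩ i p hp
    exact (e.inv_run τ i).exists_of_some hp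
  returns i t c ho := by
    obtain ⟨τ, hτ⟩ := (h.2 i (t, c)).1 ho
    have hinv := e.inv_run τ i
    have hin := fun s => (h.1 i s).2
    cases hl : (e.run τ).loc i with
    | done s t' c' =>
      rw [hl] at hτ hinv
      cases hτ
      obtain ⟨-, a, b, -, ha, hai, hb, hbi, ht, hc⟩ := hinv
      exact ⟨s, hin s ⟨τ, by rw [hl]; rfl⟩, a, ha, hai, b, hb, hbi, ht, hc⟩
    | _ => rw [hl] at hτ; cases hτ

theorem remaining_antitone (i : Fin n) : Antitone fun τ => ((e.run τ).loc i).remaining := by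
  refine antitone_nat_of_succ_le fun τ => ?_
  cases h : e τ with
  | none => rw [run_succ_of_none e h]
  | some ev => rw [run_succ_of_some e h]; exact (e.run τ).remaining_next_le ev i

theorem exists_output (i : Fin n) (hsteps : ∀ τ₀, ∃ τ, τ₀ ≤ τ ∧ e τ = some (.step i)) (r τ : ℕ)
    (h5 : ((e.run τ).loc i).remaining ≤ 5) (hr : ((e.run τ).loc i).remaining ≤ r) :
    ∃ τ', ((e.run τ').loc i).output ≠ none := by
  induction r generalizing τ with
  | zero => exact ⟨τ, Local.output_ne_none_of_remaining (Nat.le_zero.1 hr)⟩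
  | succ r ih =>
    obtain ⟨τ', hle, hstep⟩ := hsteps τ
    have h1 : ((e.run τ').loc i).remaining ≤ ((e.run τ).loc i).remaining :=
      e.remaining_antitone i hle
    have h2 := (e.run τ').remaining_next_step_le i (h1.trans h5)
    rw [← run_succ_of_some e hstep] at h2
    exact ih (τ' + 1) (by omega) (by omega)

end Execution

theorem waitFree : WaitFree D n := by
  rintro e i (hsteps | hpend) hinv
  · obtain ⟨τ, hτ⟩ := hinv
    exact e.exists_output i hsteps 5 τ (Local.remaining_le_five.2 hτ)
      (Local.remaining_le_five.2 hτ)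
  · by_contra h
    push Not at h
    exact hpend ⟨hinv, h⟩

end GCA

theorem mainTheorem3 {Q O R : Type*} (D : SeqObject Q O R) (n : ℕ) :
    D.IsTraceSemilattice ∧
    (∀ a : Fin n → Option D.Trace, SeqObject.Trace.CompatibleBot (Set.range (GCA.co a))) ∧
    GCA.WaitFree D n ∧
    ∀ e : GCA.Execution D n, ∃ inp out, e.HasOutcome inp out ∧ GCASpec inp out := by
  -- The traces in `Set.range (GCA.co a)` are by definition the entries of `GCA.co a`, so
  -- `GCA.compatible_co` applies as it stands.
  refine ⟨SeqObject.Trace.isTraceSemilattice, GCA.compatible_co, GCA.waitFree, fun e => ?_⟩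
  obtain ⟨inp, out, h⟩ := e.exists_hasOutcome
  exact ⟨inp, out, h, h.viewHistory.gcaSpec⟩
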